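/- Let $X$ be a paracompact, locally contractible Hausdorff space, and let $E\subset X\times\mathbb C$ be a closed subset such that the first projection $q=p_1|_E:E\to X$ is a countably infinite-sheeted covering. For $U\subset X$ open let $\mathcal O(U)$ be the ring of continuous functions $h:U\times\mathbb C\to\mathbb C$ with $h(x,\cdot)$ entire for every $x\in U$, and let $\mathcal O^\times(U)$ be the group of its nowhere-vanishing elements, so that $$0\to\mathbb Z\xrightarrow{\;2\pi i\;}\mathcal O\xrightarrow{\;\exp\;}\mathcal O^\times\to 1$$ is an exact sequence of sheaves, with connecting homomorphism $\delta:H^1(X;\mathcal O^\times)\to H^2(X;\mathbb Z)$ (Čech cohomology). A local realization of $E$ over $U$ is an $F\in\mathcal O(U)$ such that $F(x,\cdot)$ has only simple zeros for every $x\in U$ and $\{(x,z)\in U\times\mathbb C: F(x,z)=0\}=E\cap(U\times\mathbb C)$. For example, if $E\cap (U\times\mathbb C)$ is the disjoint union of the graphs of continuous functions $s_n:U\to\mathbb C$, $n\ge1$, all of which avoid a constant $c\in\mathbb C$, one may take the Weierstrass product $F(x,z)=\prod_{n\ge1}\mathcal E_n\bigl(\tfrac{z-c}{s_n(x)-c}\bigr)$,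 where $\mathcal E_p(w)=(1-w)\exp\bigl(w+\tfrac{w^2}{2}+\dots+\tfrac{w^p}{p}\bigr)$. (1) There are an open cover $\{U_i\}$ of $X$ and Weierstrass products $F_i$ for $E$ over $U_i$. For every open cover $\{U_i\}$ and all local realizations $F_i$ of $E$ over $U_i$, the ratios $h_{ij}=F_i/F_j$ extend to a Čech $1$-cocycle with values in $\mathcal O^\times$, and the class $c_1(E):=\delta([h_{ij}])\in H^2(X;\mathbb Z)$ does not depend on the cover or on the $F_i$. (2) $c_1(E)=0$ if and only if there is a continuous function $F:X\times\mathbb C\to\mathbb C$ such that $F(x,\cdot)$ is entire with only simple zeros for every $x\in X$ and $\{(x,z): F(x,z)=0\}=E$. (3) In particular, if $H^2(X;\mathbb Z)=0$, then every such $E$ is the zero locus of such an $F$. -/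

import Mathlib

noncomputable section

open CategoryTheory TopologicalSpace Opposite

universe u

namespace WeierstrassCovering

/-! ### Čech cohomology of a topological space with coefficients in an abelian presheaf -/

section Cech

variable {X : Type u} [TopologicalSpace X]

/-- Restriction of sections of an abelian presheaf. -/
def res (P : (Opens X)ᵒᵖ ⥤ AddCommGrpCat.{u}) {U V : Opens X} (h : V ≤ U) :
    P.obj (op U) →+ P.obj (op V) :=
  (P.map (homOfLE h).op).hom

theorem res_res (P : (Opens X)ᵒᵖ ⥤ AddCommGrpCat.{u}) {U V W : Opens X} (h : V ≤ U) (k : W ≤ V)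
    (a : P.obj (op U)) : res P k (res P h a) = res P (k.trans h) a := by
  have e : (homOfLE (k.trans h)).op = (homOfLE h).op ≫ (homOfLE k).op := rfl
  simp only [res, e, P.map_comp]
  rfl

theorem res_self (P : (Opens X)ᵒᵖ ⥤ AddCommGrpCat.{u}) {U : Opens X} (h : U ≤ U)
    (a : P.obj (op U)) : res P h a = a := by
  have e : (homOfLE h).op = 𝟙 (op U) := rfl
  simp only [res, e, P.map_id]
  rfl

variable (X) in
/-- An open cover indexed by the points of the space, the set with index `x` containing `x`.
Every open cover is refined by one of this form, so the limit over these covers is the usual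
Čech cohomology; and between two of them there is at most one refinement that fixes the indices. -/
@[ext]
structure PointCover where
  set : X → Opens X
  mem : ∀ x, x ∈ set x

namespace PointCover

/-- `U ≤ V` means that `V` refines `U`. -/
instance : PartialOrder (PointCover X) where
  le U V := ∀ x, V.set x ≤ U.set x
  le_refl _ _ := le_rfl
  le_trans _ _ _ h k x := (k x).trans (h x)
  le_antisymm _ _ h k := PointCover.ext (funext fun x => le_antisymm (k x) (h x))

instance : Nonempty (PointCover X) := ⟨⟨fun _ => ⊤, fun _ => trivial⟩⟩

instance : IsDirectedOrder (PointCover X) where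
  directed U V := ⟨⟨fun x => U.set x ⊓ V.set x, fun x => ⟨U.mem x, V.mem x⟩⟩,
    fun _ => inf_le_left, fun _ => inf_le_right⟩

instance : DecidableEq (PointCover X) := Classical.decEq _

/-- The intersection `U_{x₀} ∩ ⋯ ∩ U_{xₙ}`. -/
def inter (U : PointCover X) {n : ℕ} (s : Fin (n + 1) → X) : Opens X := ⨅ i, U.set (s i)

theorem inter_le (U : PointCover X) {n : ℕ} (s : Fin (n + 1) → X) (i : Fin (n + 1)) :
    U.inter s ≤ U.set (s i) := iInf_le _ i

theorem inter_le_face (U : PointCover X) {n : ℕ} (s : Fin (n + 2) → X) (i : Fin (n + 2)) :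
    U.inter s ≤ U.inter (s ∘ i.succAbove) := le_iInf fun j => iInf_le _ (i.succAbove j)

theorem inter_mono {U V : PointCover X} (h : U ≤ V) {n : ℕ} (s : Fin (n + 1) → X) :
    V.inter s ≤ U.inter s := iInf_mono fun i => h (s i)

end PointCover

variable (P : (Opens X)ᵒᵖ ⥤ AddCommGrpCat.{u}) (U : PointCover X)

/-- Čech `n`-cochains of the cover `U` with values in `P`. -/
abbrev Cochain (n : ℕ) : Type u := ∀ s : Fin (n + 1) → X, P.obj (op (U.inter s))

/-- The Čech differential, the alternating sum of the restricted faces. -/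
def d (n : ℕ) : Cochain P U n →+ Cochain P U (n + 1) where
  toFun c s := ∑ i : Fin (n + 2),
    (-1 : ℤ) ^ (i : ℕ) • res P (U.inter_le_face s i) (c (s ∘ i.succAbove))
  map_zero' := by
    funext s
    simp
  map_add' a b := by
    funext s
    simp [Finset.sum_add_distrib]

/-- Čech cocycles. -/
def cocycles (n : ℕ) : AddSubgroup (Cochain P U n) := (d P U n).ker

/-- Čech coboundaries. -/
def coboundaries : (n : ℕ) → AddSubgroup (Cochain P U n)
  | 0 => ⊥
  | n + 1 => (d P U n).range

/-- Čech cohomology of the cover `U`: cocycles modulo coboundaries. -/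
abbrev CoverH (n : ℕ) : Type u :=
  cocycles P U n ⧸ (coboundaries P U n).addSubgroupOf (cocycles P U n)

variable {U}

/-- Restriction of cochains to a refinement. -/
def refine {V : PointCover X} (h : U ≤ V) (n : ℕ) : Cochain P U n →+ Cochain P V n where
  toFun c s := res P (PointCover.inter_mono h s) (c s)
  map_zero' := by
    funext s
    simp
  map_add' a b := by
    funext s
    simp

theorem d_refine {V : PointCover X} (h : U ≤ V) (n : ℕ) (c : Cochain P U n) :
    d P V n (refine P h n c) = refine P h (n + 1) (d P U n c) := by
  funext s
  simp only [d, refine, AddMonoidHom.coe_mk, ZeroHom.coe_mk, map_sum, map_zsmul, res_res]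

theorem refine_mem_cocycles {V : PointCover X} (h : U ≤ V) {n : ℕ} {c : Cochain P U n}
    (hc : c ∈ cocycles P U n) : refine P h n c ∈ cocycles P V n := by
  have hc' : d P U n c = 0 := hc
  change d P V n (refine P h n c) = 0
  rw [d_refine, hc', map_zero]

theorem refine_mem_coboundaries {V : PointCover X} (h : U ≤ V) {n : ℕ} {c : Cochain P U n}
    (hc : c ∈ coboundaries P U n) : refine P h n c ∈ coboundaries P V n := by
  cases n with
  | zero =>
    have hc' : c = 0 := hc
    rw [hc', map_zero]
    exact zero_mem _
  | succ n =>
    obtain ⟨b, rfl⟩ := hc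
    exact ⟨refine P h n b, d_refine P h n b⟩

/-- Restriction of cocycles to a refinement. -/
def refineCocycles {V : PointCover X} (h : U ≤ V) (n : ℕ) : cocycles P U n →+ cocycles P V n :=
  ((refine P h n).comp (cocycles P U n).subtype).codRestrict _
    fun c => refine_mem_cocycles P h c.2

/-- The map induced by a refinement on the cohomology of covers. -/
def refineH (n : ℕ) (U V : PointCover X) (h : U ≤ V) : CoverH P U n →+ CoverH P V n :=
  QuotientAddGroup.map _ _ (refineCocycles P h n)
    fun _ hc => refine_mem_coboundaries P h hc

instance (n : ℕ) : DirectedSystem (CoverH P · n) (fun U V h => refineH P n U V h) where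
  map_self := by
    intro U c
    induction c using QuotientAddGroup.induction_on with
    | H c =>
      refine congrArg _ (Subtype.ext (funext fun s => ?_))
      exact res_self P _ _
  map_map := by
    intro U V W h k c
    induction c using QuotientAddGroup.induction_on with
    | H c =>
      refine congrArg _ (Subtype.ext (funext fun s => ?_))
      exact res_res P _ _ _

/-- Čech cohomology `Ȟⁿ(X; P)`, the direct limit over all open covers. -/
abbrev CechH (n : ℕ) : Type u :=
  AddCommGroup.DirectLimit (CoverH P · n) (refineH P n)

/-- The Čech cohomology class of a cocycle of a cover. -/
def cechClass (U : PointCover X) (n : ℕ) : cocycles P U n →+ CechH P n :=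
  (AddCommGroup.DirectLimit.of (CoverH P · n) (refineH P n) U).comp
    (QuotientAddGroup.mk' _)

variable {P} {A B C : (Opens X)ᵒᵖ ⥤ AddCommGrpCat.{u}}

/-- The map on cochains induced by a morphism of presheaves. -/
def mapCochain (f : A ⟶ B) (U : PointCover X) (n : ℕ) : Cochain A U n →+ Cochain B U n where
  toFun c s := (f.app (op (U.inter s))).hom (c s)
  map_zero' := by
    funext s
    simp
  map_add' a b := by
    funext s
    simp

/-- The graph of the connecting homomorphism `δ : Ȟⁿ(X; C) → Ȟⁿ⁺¹(X; A)` of a short exact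
sequence `0 ⟶ A ⟶ B ⟶ C ⟶ 0`: on some cover, lift a cocycle `γ` representing `c` to a cochain `b`
of `B`; the cocycle `α` of `A` that maps to `d b` represents `δ c`. -/
def IsConnecting (f : A ⟶ B) (g : B ⟶ C) (n : ℕ) (c : CechH C n) (a : CechH A (n + 1)) : Prop :=
  ∃ (U : PointCover X) (γ : cocycles C U n) (b : Cochain B U n) (α : cocycles A U (n + 1)),
    cechClass C U n γ = c ∧ mapCochain g U n b = γ ∧
    mapCochain f U (n + 1) α = d B U n b ∧ cechClass A U (n + 1) α = a

end Cech

/-! ### The exponential sequence of entire families -/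

section Exponential

variable {X : Type u} [TopologicalSpace X]

/-- The ring `𝒪(U)` of continuous functions `U × ℂ → ℂ` that are entire in the second variable. -/
def entireFamilies (U : Opens X) : Subring (U × ℂ → ℂ) where
  carrier := {h | Continuous h ∧ ∀ x, Differentiable ℂ fun z => h (x, z)}
  mul_mem' ha hb := ⟨ha.1.mul hb.1, fun x => (ha.2 x).mul (hb.2 x)⟩
  one_mem' := ⟨continuous_const, fun _ => differentiable_const _⟩
  add_mem' ha hb := ⟨ha.1.add hb.1, fun x => (ha.2 x).add (hb.2 x)⟩
  zero_mem' := ⟨continuous_const, fun _ => differentiable_const _⟩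
  neg_mem' ha := ⟨ha.1.neg, fun x => (ha.2 x).neg⟩

/-- The units of `𝒪(U)` are its nowhere vanishing elements. -/
theorem isUnit_iff_ne_zero {U : Opens X} (h : entireFamilies U) :
    IsUnit h ↔ ∀ p, h.1 p ≠ 0 := by
  constructor
  · rintro ⟨v, rfl⟩ p hp
    have e : (v : entireFamilies U).1 p * ((v⁻¹ : (entireFamilies U)ˣ) : entireFamilies U).1 p = 1 :=
      congrFun (congrArg Subtype.val v.mul_inv) p
    rw [hp, zero_mul] at e
    exact zero_ne_one e
  · intro hp
    refine IsUnit.of_mul_eq_one ⟨fun p => (h.1 p)⁻¹, h.2.1.inv₀ hp, fun x => ?_⟩ ?_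
    · exact (h.2.2 x).fun_inv fun z => hp (x, z)
    · exact Subtype.ext (funext fun p => mul_inv_cancel₀ (hp p))

/-- Restriction of entire families to a smaller open set. -/
def restrict {U V : Opens X} (h : V ≤ U) : entireFamilies U →+* entireFamilies V where
  toFun f := ⟨fun p => f.1 (Set.inclusion h p.1, p.2),
    f.2.1.comp (((continuous_inclusion h).comp continuous_fst).prodMk continuous_snd),
    fun x => f.2.2 (Set.inclusion h x)⟩
  map_one' := rfl
  map_mul' _ _ := rfl
  map_zero' := rfl
  map_add' _ _ := rfl

/-- The exponential of an entire family, as a nowhere vanishing entire family. -/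
def expUnit {U : Opens X} (f : entireFamilies U) : (entireFamilies U)ˣ where
  val := ⟨fun p => Complex.exp (f.1 p), Complex.continuous_exp.comp f.2.1,
    fun x => (f.2.2 x).cexp⟩
  inv := ⟨fun p => Complex.exp (-f.1 p), Complex.continuous_exp.comp f.2.1.neg,
    fun x => (f.2.2 x).neg.cexp⟩
  val_inv := Subtype.ext (funext fun p => by simp [← Complex.exp_add])
  inv_val := Subtype.ext (funext fun p => by simp [← Complex.exp_add])

variable (X)

/-- The constant sheaf `ℤ`: locally constant integer-valued functions. -/
def sheafZ : (Opens X)ᵒᵖ ⥤ AddCommGrpCat.{u} where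
  obj U := AddCommGrpCat.of (LocallyConstant U.unop ℤ)
  map i := AddCommGrpCat.ofHom
    { toFun := fun f => f.comap ⟨Set.inclusion i.unop.le, continuous_inclusion i.unop.le⟩
      map_zero' := rfl
      map_add' := fun _ _ => rfl }

/-- The sheaf `𝒪`, under addition. -/
def sheafO : (Opens X)ᵒᵖ ⥤ AddCommGrpCat.{u} where
  obj U := AddCommGrpCat.of (entireFamilies U.unop)
  map i := AddCommGrpCat.ofHom (restrict i.unop.le).toAddMonoidHom

/-- The sheaf `𝒪ˣ` of nowhere vanishing sections of `𝒪`; its multiplication is written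
additively. -/
def sheafOUnits : (Opens X)ᵒᵖ ⥤ AddCommGrpCat.{u} where
  obj U := AddCommGrpCat.of (Additive (entireFamilies U.unop)ˣ)
  map i := AddCommGrpCat.ofHom
    (MonoidHom.toAdditive (Units.map (restrict i.unop.le).toMonoidHom))

/-- The inclusion `ℤ ≅ 2πiℤ ⟶ 𝒪`. -/
def twoPiI : sheafZ X ⟶ sheafO X where
  app U := AddCommGrpCat.ofHom
    { toFun := fun n => ⟨fun p => 2 * Real.pi * Complex.I * (n p.1 : ℂ),
        continuous_const.mul
          ((continuous_of_discreteTopology (f := fun k : ℤ => (k : ℂ))).comp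
            (n.continuous.comp continuous_fst)),
        fun x => differentiable_const (2 * Real.pi * Complex.I * (n x : ℂ))⟩
      map_zero' := Subtype.ext (funext fun p => by simp)
      map_add' := fun a b => Subtype.ext (funext fun p => by simp [mul_add]) }

/-- The exponential map `exp : 𝒪 ⟶ 𝒪ˣ`. -/
def expMap : sheafO X ⟶ sheafOUnits X where
  app U := AddCommGrpCat.ofHom
    { toFun := fun f => Additive.ofMul (expUnit f)
      map_zero' := congrArg Additive.ofMul
        (Units.ext (Subtype.ext (funext fun _ => Complex.exp_zero)))
      map_add' := fun a b => congrArg Additive.ofMul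
        (Units.ext (Subtype.ext (funext fun p => Complex.exp_add (a.1 p) (b.1 p)))) }

/-- `H²(X; ℤ)`. -/
abbrev H2Z : Type u := CechH (sheafZ X) 2

end Exponential

/-! ### Embedded coverings, Weierstrass families and the obstruction class -/

section Coverings

variable {X : Type u} [TopologicalSpace X]

/-- `E ⊆ X × ℂ` is a countably infinite-sheeted covering of `X` under the first projection. -/
def IsCountableCovering (E : Set (X × ℂ)) : Prop :=
  IsCoveringMap (fun e : E => e.1.1) ∧
    ∀ x, {z | (x, z) ∈ E}.Countable ∧ {z | (x, z) ∈ E}.Infinite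

/-- A closed embedded countable covering of `X`. -/
def IsClosedEmbeddedCovering (E : Set (X × ℂ)) : Prop :=
  IsClosed E ∧ IsCountableCovering E

/-- The zero locus `Z(F)`. -/
def zeroLocus (F : X × ℂ → ℂ) : Set (X × ℂ) := {p | F p = 0}

/-- A Weierstrass entire family. -/
structure IsWeierstrassFamily (F : X × ℂ → ℂ) : Prop where
  continuous : Continuous F
  entire : ∀ x, Differentiable ℂ fun z => F (x, z)
  covering : IsCountableCovering (zeroLocus F)

/-- Every `F (x, ·)` has only simple zeros. -/
def HasSimpleZeros (F : X × ℂ → ℂ) : Prop :=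
  ∀ x z, F (x, z) = 0 → deriv (fun w => F (x, w)) z ≠ 0

/-- `E` is the zero locus of a Weierstrass entire family, each point counted once. -/
def IsRealizable (E : Set (X × ℂ)) : Prop :=
  ∃ F : X × ℂ → ℂ, IsWeierstrassFamily F ∧ HasSimpleZeros F ∧ zeroLocus F = E

/-- `F ∈ 𝒪(U)` vanishes exactly on `E` over `U`, with simple zeros. -/
def IsLocalRealization (E : Set (X × ℂ)) (U : Opens X) (F : entireFamilies U) : Prop :=
  ∀ (x : U) (z : ℂ), (F.1 (x, z) = 0 ↔ ((x : X), z) ∈ E) ∧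
    (F.1 (x, z) = 0 → deriv (fun w => F.1 (x, w)) z ≠ 0)

/-- The Weierstrass elementary factor `(1 - w) exp (w + w ^ 2 / 2 + ⋯ + w ^ p / p)`. -/
def elementaryFactor (p : ℕ) (w : ℂ) : ℂ :=
  (1 - w) * Complex.exp (∑ k ∈ Finset.Icc 1 p, w ^ k / k)

/-- `F ∈ 𝒪(U)` is a Weierstrass product for `E` over `U`: there `E` is the disjoint union of the
graphs of continuous functions `s₁, s₂, …` (here indexed from `0`) which all avoid the constant
`c`, and `F (x, z) = ∏ₙ 𝓔ₙ ((z - c) / (sₙ x - c))`. -/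
def IsLocalWeierstrassProduct (E : Set (X × ℂ)) (U : Opens X) (F : entireFamilies U) : Prop :=
  ∃ (c : ℂ) (s : ℕ → U → ℂ), (∀ n, Continuous (s n)) ∧
    (∀ x, Function.Injective fun n => s n x) ∧
    (∀ (x : U) (z : ℂ), ((x : X), z) ∈ E ↔ ∃ n, s n x = z) ∧
    (∀ n x, s n x ≠ c) ∧
    ∀ (x : U) (z : ℂ),
      HasProd (fun n => elementaryFactor (n + 1) ((z - c) / (s n x - c))) (F.1 (x, z))

/-- The cocycle `h` of `𝒪ˣ` consists of the ratios `F_x / F_y` of the local sections `F_x`. -/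
def IsRatioCocycle (U : PointCover X) (F : ∀ x, entireFamilies (U.set x))
    (h : cocycles (sheafOUnits X) U 1) : Prop :=
  ∀ s : Fin 2 → X, restrict (U.inter_le s 0) (F (s 0)) =
    ((Additive.toMul (h.1 s : Additive (entireFamilies (U.inter s))ˣ) :
      (entireFamilies (U.inter s))ˣ) : entireFamilies (U.inter s)) *
      restrict (U.inter_le s 1) (F (s 1))

/-- `a = δ [F_x / F_y]`, for the connecting homomorphism `δ : H¹(X; 𝒪ˣ) → H²(X; ℤ)` of the
exponential sequence. -/
def IsRatioClass (U : PointCover X) (F : ∀ x, entireFamilies (U.set x)) (a : H2Z X) : Prop :=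
  ∃ h : cocycles (sheafOUnits X) U 1, IsRatioCocycle U F h ∧
    IsConnecting (twoPiI X) (expMap X) 1 (cechClass (sheafOUnits X) U 1 h) a

/-- `a` is the class obtained from some cover with local Weierstrass products for `E`. -/
def IsObstructionClass (E : Set (X × ℂ)) (a : H2Z X) : Prop :=
  ∃ (U : PointCover X) (F : ∀ x, entireFamilies (U.set x)),
    (∀ x, IsLocalWeierstrassProduct E (U.set x) (F x)) ∧ IsRatioClass U F a

/-- The obstruction class `c₁(E) ∈ H²(X; ℤ)`: the class obtained from any choice of local
Weierstrass products. -/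
def c1 (E : Set (X × ℂ)) : H2Z X := Classical.epsilon (IsObstructionClass E)

end Coverings

end WeierstrassCovering

end

noncomputable section

open CategoryTheory TopologicalSpace Opposite

universe u

namespace WeierstrassCovering

/-! ### Čech cochains of low degree -/

section LowDegree

variable {X : Type u} [TopologicalSpace X]
variable {P : (Opens X)ᵒᵖ ⥤ AddCommGrpCat.{u}} {U : PointCover X}

/-! The class depends only on `E` because local realizations are unique up to units of `𝒪`. If `F`
and `G` realize `E` over `U`, then `F / G` extends across the common simple zeros to an entire
function on each fibre; the maximum principle makes the extension jointly continuous, so it is a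
unit (`IsLocalRealization.exists_unit`). A realization is a non-zero-divisor, hence the ratios
satisfy the cocycle relation, and other choices change the cocycle by a coboundary
(`IsRatioCocycle.cechClass_eq`).

Passing to `H²(X; ℤ)` requires the relation `IsConnecting` to be single-valued and total. Both
follow from exactness of the exponential sequence (`isLeftExact_exp`, `isLocallySurjective_exp`);
for totality, paracompactness turns local liftability on double overlaps into a lift on one refined
cover (`IsLocallySurjective.exists_lift_one`).

Realizations exist locally: `E` is closed and evenly covered, so near a point of `X` it consists of
numbered graphs, only finitely many of which meet a given disc, and the Weierstrass product
converges locally uniformly.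

A partition of unity on `X` kills `H¹(X; 𝒪)`, so a class of `H¹(X; 𝒪ˣ)` with `δ` equal to zero is
itself zero. The ratios are then a coboundary on a refinement, and multiplying by the units that
witness this makes the local realizations agree and glue. Conversely, a global realization on the
trivial cover has all ratios equal to 1. -/

theorem PointCover.mem_inter {n : ℕ} {s : Fin (n + 1) → X} {x : X} :
    x ∈ U.inter s ↔ ∀ i, x ∈ U.set (s i) := by
  have h : ((U.inter s : Opens X) : Set X) = ⋂ i, (U.set (s i) : Set X) := by
    rw [PointCover.inter, Opens.coe_iInf]
  rw [← SetLike.mem_coe, h, Set.mem_iInter]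
  rfl

theorem PointCover.le_inter_pair {V : Opens X} {x y : X} (hx : V ≤ U.set x) (hy : V ≤ U.set y) :
    V ≤ U.inter ![x, y] := le_iInf fun i => by
  fin_cases i
  · exact hx
  · exact hy

theorem PointCover.inter_const_ge (U : PointCover X) (x : X) :
    U.set x ≤ U.inter (fun _ : Fin 1 => x) := le_iInf fun _ => le_rfl

/-- Faces such as `s ∘ i.succAbove` and `![s 1, s 2]` agree only propositionally, so the two cochain
values have different types; restriction to a common open set makes them comparable. -/
theorem res_cochain_congr {n : ℕ} (c : Cochain P U n) {s t : Fin (n + 1) → X} (e : s = t)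
    {V : Opens X} (hs : V ≤ U.inter s) (ht : V ≤ U.inter t) :
    res P hs (c s) = res P ht (c t) := by
  subst e
  rfl

/-- The differential of a `0`-cochain is the difference of its values. -/
theorem d_zero_apply (e : Cochain P U 0) (s : Fin 2 → X) :
    d P U 0 e s =
      res P ((U.inter_le s 1).trans (U.inter_const_ge _)) (e fun _ => s 1) -
      res P ((U.inter_le s 0).trans (U.inter_const_ge _)) (e fun _ => s 0) := by
  have h0 : s ∘ (0 : Fin 2).succAbove = fun _ => s 1 := by
    funext i; fin_cases i; rfl
  have h1 : s ∘ (1 : Fin 2).succAbove = fun _ => s 0 := by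
    funext i; fin_cases i; rfl
  have key : d P U 0 e s = res P (U.inter_le_face s 0) (e (s ∘ (0 : Fin 2).succAbove)) +
      -res P (U.inter_le_face s 1) (e (s ∘ (1 : Fin 2).succAbove)) := by
    change ∑ i : Fin 2, (-1 : ℤ) ^ (i : ℕ) •
        res P (U.inter_le_face s i) (e (s ∘ i.succAbove)) = _
    rw [Fin.sum_univ_two]
    simp
  rw [key, sub_eq_add_neg]
  exact congrArg₂ _ (res_cochain_congr e h0 _ _) (congrArg _ (res_cochain_congr e h1 _ _))

/-- The differential of a `1`-cochain. -/
theorem d_one_apply (c : Cochain P U 1) (s : Fin 3 → X) :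
    d P U 1 c s =
      res P (PointCover.le_inter_pair (U.inter_le s 1) (U.inter_le s 2)) (c ![s 1, s 2]) -
      res P (PointCover.le_inter_pair (U.inter_le s 0) (U.inter_le s 2)) (c ![s 0, s 2]) +
      res P (PointCover.le_inter_pair (U.inter_le s 0) (U.inter_le s 1)) (c ![s 0, s 1]) := by
  have h0 : s ∘ (0 : Fin 3).succAbove = ![s 1, s 2] := by
    funext i; fin_cases i <;> rfl
  have h1 : s ∘ (1 : Fin 3).succAbove = ![s 0, s 2] := by
    funext i; fin_cases i <;> rfl
  have h2 : s ∘ (2 : Fin 3).succAbove = ![s 0, s 1] := by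
    funext i; fin_cases i <;> rfl
  have key : d P U 1 c s = res P (U.inter_le_face s 0) (c (s ∘ (0 : Fin 3).succAbove)) +
      -res P (U.inter_le_face s 1) (c (s ∘ (1 : Fin 3).succAbove)) +
      res P (U.inter_le_face s 2) (c (s ∘ (2 : Fin 3).succAbove)) := by
    change ∑ i : Fin 3, (-1 : ℤ) ^ (i : ℕ) •
        res P (U.inter_le_face s i) (c (s ∘ i.succAbove)) = _
    rw [Fin.sum_univ_three]
    simp
  rw [key, sub_eq_add_neg]
  exact congrArg₂ _ (congrArg₂ _ (res_cochain_congr c h0 _ _)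
    (congrArg _ (res_cochain_congr c h1 _ _))) (res_cochain_congr c h2 _ _)

/-- Allowing any `V` inside the triple intersection lets the relation be used on overlaps of finer
covers and with auxiliary indices. -/
theorem cocycle_relation {c : Cochain P U 1} (hc : c ∈ cocycles P U 1) {V : Opens X} {x y z : X}
    (hx : V ≤ U.set x) (hy : V ≤ U.set y) (hz : V ≤ U.set z) :
    res P (PointCover.le_inter_pair hx hz) (c ![x, z]) =
      res P (PointCover.le_inter_pair hx hy) (c ![x, y]) +
      res P (PointCover.le_inter_pair hy hz) (c ![y, z]) := by
  have h : d P U 1 c ![x, y, z] = 0 := congrFun (show d P U 1 c = 0 from hc) _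
  rw [d_one_apply] at h
  have hV : V ≤ U.inter ![x, y, z] := le_iInf fun i => by
    fin_cases i
    · exact hx
    · exact hy
    · exact hz
  have h' := congrArg (res P hV) h
  rw [map_zero, map_add, map_sub, res_res, res_res, res_res] at h'
  rw [← sub_eq_zero, ← neg_eq_zero, ← h']
  change -(res P _ (c ![x, z]) - (_ + _)) =
    res P _ (c ![y, z]) - res P _ (c ![x, z]) + res P _ (c ![x, y])
  abel

/-- A `1`-cochain satisfying the cocycle relation is a cocycle. -/
theorem mem_cocycles_one {c : Cochain P U 1}
    (h : ∀ s : Fin 3 → X,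
      res P (PointCover.le_inter_pair (U.inter_le s 0) (U.inter_le s 2)) (c ![s 0, s 2]) =
      res P (PointCover.le_inter_pair (U.inter_le s 0) (U.inter_le s 1)) (c ![s 0, s 1]) +
      res P (PointCover.le_inter_pair (U.inter_le s 1) (U.inter_le s 2)) (c ![s 1, s 2])) :
    c ∈ cocycles P U 1 := by
  change d P U 1 c = 0
  funext s
  rw [d_one_apply, h]
  simp only [Pi.zero_apply]
  abel

theorem d_d_zero (e : Cochain P U 0) : d P U 1 (d P U 0 e) = 0 := by
  funext s
  rw [d_one_apply, d_zero_apply, d_zero_apply, d_zero_apply]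
  simp only [map_sub, res_res, Pi.zero_apply]
  change res P _ (e fun _ => s 2) - res P _ (e fun _ => s 1) -
    (res P _ (e fun _ => s 2) - res P _ (e fun _ => s 0)) +
    (res P _ (e fun _ => s 1) - res P _ (e fun _ => s 0)) = 0
  abel

theorem d_d_one (c : Cochain P U 1) : d P U 2 (d P U 1 c) = 0 := by
  funext s
  change ∑ i : Fin 4, (-1 : ℤ) ^ (i : ℕ) •
      res P (U.inter_le_face s i) (d P U 1 c (s ∘ i.succAbove)) = _
  rw [Fin.sum_univ_four]
  simp only [d_one_apply, map_add, map_sub, res_res, Pi.zero_apply]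
  change (-1 : ℤ) ^ 0 • (res P _ (c ![s 2, s 3]) - res P _ (c ![s 1, s 3]) +
      res P _ (c ![s 1, s 2])) +
    (-1 : ℤ) ^ 1 • (res P _ (c ![s 2, s 3]) - res P _ (c ![s 0, s 3]) + res P _ (c ![s 0, s 2])) +
    (-1 : ℤ) ^ 2 • (res P _ (c ![s 1, s 3]) - res P _ (c ![s 0, s 3]) + res P _ (c ![s 0, s 1])) +
    (-1 : ℤ) ^ 3 • (res P _ (c ![s 1, s 2]) - res P _ (c ![s 0, s 2]) + res P _ (c ![s 0, s 1])) = 0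
  simp only [pow_succ, pow_zero, mul_neg, mul_one, neg_neg, one_smul, neg_smul]
  abel

/-- The `0`-cochain given by a section over each member of the cover. -/
def ofFamily (g : ∀ x, P.obj (op (U.set x))) : Cochain P U 0 :=
  fun s => res P (U.inter_le s 0) (g (s 0))

theorem d_ofFamily (g : ∀ x, P.obj (op (U.set x))) (s : Fin 2 → X) :
    d P U 0 (ofFamily g) s =
      res P (U.inter_le s 1) (g (s 1)) - res P (U.inter_le s 0) (g (s 0)) := by
  rw [d_zero_apply]
  simp only [ofFamily, res_res]

theorem cechClass_refine {V : PointCover X} (h : U ≤ V) {n : ℕ} (c : cocycles P U n) :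
    cechClass P V n (refineCocycles P h n c) = cechClass P U n c :=
  AddCommGroup.DirectLimit.of_f (G := (CoverH P · n)) (f := refineH P n) h
    (QuotientAddGroup.mk' _ c)

theorem cechClass_eq_zero_of_mem {n : ℕ} {c : cocycles P U n}
    (hc : (c : Cochain P U n) ∈ coboundaries P U n) : cechClass P U n c = 0 := by
  have : QuotientAddGroup.mk' ((coboundaries P U n).addSubgroupOf (cocycles P U n)) c = 0 :=
    (QuotientAddGroup.eq_zero_iff _).2 hc
  rw [cechClass, AddMonoidHom.comp_apply, this, map_zero]

/-- A cocycle with trivial class becomes a coboundary on a refinement. -/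
theorem exists_refine_mem_coboundaries {n : ℕ} {c : cocycles P U n}
    (hc : cechClass P U n c = 0) :
    ∃ (V : PointCover X) (h : U ≤ V), refine P h n c ∈ coboundaries P V n := by
  obtain ⟨V, h, hV⟩ := AddCommGroup.DirectLimit.of.zero_exact (G := (CoverH P · n))
    (f := refineH P n) U _ hc
  exact ⟨V, h, (QuotientAddGroup.eq_zero_iff (refineCocycles P h n c)).1 hV⟩

theorem refine_refine {V W : PointCover X} (h : U ≤ V) (k : V ≤ W) {n : ℕ} (c : Cochain P U n) :
    refine P k n (refine P h n c) = refine P (h.trans k) n c :=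
  funext fun _ => res_res P _ _ _

/-- Two cocycles with the same class differ by a coboundary on a common refinement. -/
theorem exists_refine_sub_mem_coboundaries {U' : PointCover X} {n : ℕ} {c : cocycles P U n}
    {c' : cocycles P U' n} (hc : cechClass P U n c = cechClass P U' n c') :
    ∃ (V : PointCover X) (h : U ≤ V) (h' : U' ≤ V),
      refine P h n c - refine P h' n c' ∈ coboundaries P V n := by
  obtain ⟨W, k, k'⟩ := exists_ge_ge U U'
  have : cechClass P W n (refineCocycles P k n c - refineCocycles P k' n c') = 0 := by
    rw [map_sub, cechClass_refine, cechClass_refine, hc, sub_self]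
  obtain ⟨V, h, hV⟩ := exists_refine_mem_coboundaries this
  refine ⟨V, k.trans h, k'.trans h, ?_⟩
  have e : refine P h n (refineCocycles P k n c - refineCocycles P k' n c' : cocycles P W n) =
      refine P (k.trans h) n c - refine P (k'.trans h) n c' := by
    rw [AddSubgroup.coe_sub, map_sub]
    exact congrArg₂ _ (refine_refine k h _) (refine_refine k' h _)
  rwa [e] at hV

end LowDegree

/-! ### The connecting homomorphism -/

section Connecting

variable {X : Type u} [TopologicalSpace X] {A B C : (Opens X)ᵒᵖ ⥤ AddCommGrpCat.{u}}

theorem app_res (g : B ⟶ C) {U V : Opens X} (h : V ≤ U) (b : B.obj (op U)) :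
    (g.app (op V)).hom (res B h b) = res C h ((g.app (op U)).hom b) :=
  ConcreteCategory.congr_hom (g.naturality (homOfLE h).op) b

theorem mapCochain_d (g : B ⟶ C) (U : PointCover X) (n : ℕ) (b : Cochain B U n) :
    mapCochain g U (n + 1) (d B U n b) = d C U n (mapCochain g U n b) := by
  funext s
  simp only [d, mapCochain, AddMonoidHom.coe_mk, ZeroHom.coe_mk, map_sum, map_zsmul, app_res]

theorem mapCochain_refine (g : B ⟶ C) {U V : PointCover X} (h : U ≤ V) (n : ℕ)
    (b : Cochain B U n) :
    mapCochain g V n (refine B h n b) = refine C h n (mapCochain g U n b) :=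
  funext fun _ => app_res g _ _

/-- Every section of `C` lifts locally to `B`. -/
def IsLocallySurjective (g : B ⟶ C) : Prop :=
  ∀ (U : Opens X) (c : C.obj (op U)), ∀ x ∈ U,
    ∃ (V : Opens X) (h : V ≤ U) (b : B.obj (op V)), x ∈ V ∧ (g.app (op V)).hom b = res C h c

/-- The kernel of `g` on sections is the image of `f`, and `f` is injective on sections. -/
structure IsLeftExact (f : A ⟶ B) (g : B ⟶ C) : Prop where
  injective : ∀ U : Opens X, Function.Injective (f.app (op U)).hom
  comp_eq_zero : ∀ (U : Opens X) (a : A.obj (op U)),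
    (g.app (op U)).hom ((f.app (op U)).hom a) = 0
  exists_of_eq_zero : ∀ (U : Opens X) (b : B.obj (op U)), (g.app (op U)).hom b = 0 →
    ∃ a : A.obj (op U), (f.app (op U)).hom a = b

variable {f : A ⟶ B} {g : B ⟶ C}

theorem IsLeftExact.mapCochain_injective (hfg : IsLeftExact f g) (U : PointCover X) (n : ℕ) :
    Function.Injective (mapCochain f U n) := fun _ _ h =>
  funext fun s => hfg.injective _ (congrFun h s)

theorem IsLeftExact.exists_mapCochain (hfg : IsLeftExact f g) {U : PointCover X} {n : ℕ}
    {b : Cochain B U n} (hb : mapCochain g U n b = 0) : ∃ a, mapCochain f U n a = b := by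
  choose a ha using fun s => hfg.exists_of_eq_zero _ (b s) (congrFun hb s)
  exact ⟨a, funext ha⟩

/-- A `0`-cochain lifts on a refinement. -/
theorem IsLocallySurjective.exists_lift_zero (hg : IsLocallySurjective g) {U : PointCover X}
    (c : Cochain C U 0) :
    ∃ (V : PointCover X) (h : U ≤ V) (b : Cochain B V 0),
      mapCochain g V 0 b = refine C h 0 c := by
  choose V h b hV hb using fun x =>
    hg (U.set x) (res C (U.inter_const_ge x) (c fun _ => x)) x (U.mem x)
  refine ⟨⟨V, hV⟩, h, ofFamily (U := ⟨V, hV⟩) b, ?_⟩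
  funext s
  change (g.app _).hom (res B _ (b (s 0))) = res C _ (c s)
  rw [app_res, hb, res_res, res_res]
  refine res_cochain_congr c ?_ _ _
  funext i
  fin_cases i
  rfl

/-- The connecting homomorphism out of degree one is single-valued. -/
theorem IsConnecting.unique (hfg : IsLeftExact f g) (hg : IsLocallySurjective g)
    {c : CechH C 1} {a a' : CechH A 2} (h : IsConnecting f g 1 c a)
    (h' : IsConnecting f g 1 c a') : a = a' := by
  obtain ⟨U, γ, b, α, hγ, hb, hα, rfl⟩ := h
  obtain ⟨U', γ', b', α', hγ', hb', hα', rfl⟩ := h'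
  -- On `V` the cocycles differ by `d η`. Once `η` lifts to `e` on `W`, the cochain `b - b' - d e`
  -- dies in `C`, so it comes from some `β` in `A`; since `d (d e) = 0`, applying `d` gives `α - α'
  -- = d β`.
  obtain ⟨V, k, k', η, hη⟩ := exists_refine_sub_mem_coboundaries (hγ.trans hγ'.symm)
  obtain ⟨W, l, e, he⟩ := hg.exists_lift_zero η
  have hker : mapCochain g W 1 (refine B (k.trans l) 1 b - refine B (k'.trans l) 1 b' -
      d B W 0 e) = 0 := by
    rw [map_sub, map_sub, mapCochain_refine, mapCochain_refine, mapCochain_d, he, hb, hb',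
      d_refine, hη, map_sub, refine_refine, refine_refine, sub_self]
  obtain ⟨β, hβ⟩ := hfg.exists_mapCochain hker
  rw [← sub_eq_zero, ← cechClass_refine (k.trans l) α, ← cechClass_refine (k'.trans l) α']
  refine (map_sub (cechClass A W 2) _ _).symm.trans ?_
  refine cechClass_eq_zero_of_mem ⟨β, hfg.mapCochain_injective _ _ ?_⟩
  rw [mapCochain_d, hβ, map_sub, map_sub, d_d_zero, sub_zero, AddSubgroup.coe_sub, map_sub]
  change _ = mapCochain f W 2 (refine A (k.trans l) 2 α.1) -
    mapCochain f W 2 (refine A (k'.trans l) 2 α'.1)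
  rw [mapCochain_refine, mapCochain_refine, hα, hα', d_refine, d_refine]

open Filter Topology in
/-- On a paracompact Hausdorff space, a `1`-cocycle lifts to a cochain on a refinement. -/
theorem IsLocallySurjective.exists_lift_one [T2Space X] [ParacompactSpace X]
    (hg : IsLocallySurjective g) [Subsingleton (C.obj (op ⊥))] {U : PointCover X}
    (γ : cocycles C U 1) :
    ∃ (V : PointCover X) (h : U ≤ V) (b : Cochain B V 1),
      mapCochain g V 1 b = refine C h 1 γ := by
  -- Shrinking gives a locally finite open cover `w` with `closure (w i) ⊆ U.set i`; `τ x` selects a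
  -- member of `w` containing `x`.
  obtain ⟨v, vo, vc, vf, vU⟩ := precise_refinement (fun x => (U.set x : Set X))
    (fun x => (U.set x).2) (Set.iUnion_eq_univ_iff.2 fun x => ⟨x, U.mem x⟩)
  obtain ⟨w, wc, wo, wv⟩ := exists_iUnion_eq_closure_subset vo vf.point_finite vc
  have wf : LocallyFinite w := vf.subset fun i => subset_closure.trans (wv i)
  choose τ hτ using Set.iUnion_eq_univ_iff.1 wc
  let Lift : X → X → Opens X → Prop := fun i j V =>
    ∃ (h : V ≤ U.inter ![i, j]) (b : B.obj (op V)), (g.app (op V)).hom b = res C h (γ.1 ![i, j])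
  have lift_mono : ∀ {i j V V'}, Lift i j V → V' ≤ V → Lift i j V' := by
    rintro i j V V' ⟨h, b, hb⟩ hV
    exact ⟨hV.trans h, res B hV b, by rw [app_res, hb, res_res]⟩
  have lift_nhds : ∀ {i j x}, x ∈ U.set i → x ∈ U.set j →
      ∀ᶠ t in (𝓝 x).smallSets, ∀ V : Opens X, (V : Set X) ⊆ t → Lift i j V := by
    intro i j x hi hj
    obtain ⟨V, h, b, hx, hb⟩ := hg (U.inter ![i, j]) (γ.1 ![i, j]) x
      (PointCover.mem_inter.2 fun k => by fin_cases k <;> assumption)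
    refine eventually_smallSets.2 ⟨V, V.2.mem_nhds hx, fun t ht V' hV' => ?_⟩
    exact lift_mono ⟨h, b, hb⟩ (hV'.trans ht)
  -- By local finiteness `V` can avoid every `w i` whose closure misses `x`. Only finitely many
  -- indices remain, all with `x ∈ U.set i`, so a single `V` serves all the required local lifts.
  have key : ∀ x, ∃ V : Opens X, x ∈ V ∧ V ≤ U.set x ∧ (V : Set X) ⊆ w (τ x) ∧
      Lift (τ x) x V ∧ ∀ i, ((V : Set X) ∩ w i).Nonempty → Lift (τ x) i V := by
    intro x
    have wU : ∀ i, closure (w i) ⊆ U.set i := fun i => (wv i).trans (vU i)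
    have hxτ : x ∈ U.set (τ x) := wU _ (subset_closure (hτ x))
    have fin : {i | x ∈ closure (w i)}.Finite := wf.closure.point_finite x
    have e1 : ∀ᶠ t in (𝓝 x).smallSets, t ⊆ (U.set x : Set X) :=
      eventually_smallSets_subset.2 ((U.set x).2.mem_nhds (U.mem x))
    have e2 : ∀ᶠ t in (𝓝 x).smallSets, t ⊆ w (τ x) :=
      eventually_smallSets_subset.2 ((wo _).mem_nhds (hτ x))
    have e3 := eventually_smallSets_subset.2
      (wf.closure.iInter_compl_mem_nhds (fun _ => isClosed_closure) x)
    have e4 := (eventually_all_finite fin).2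
      fun i hi => lift_nhds hxτ (wU i hi)
    have e5 := lift_nhds hxτ (U.mem x)
    obtain ⟨t, ht, h⟩ := eventually_smallSets.1 (e1.and (e2.and (e3.and (e4.and e5))))
    obtain ⟨O, hOt, hO, hxO⟩ := mem_nhds_iff.1 ht
    obtain ⟨h1, h2, h3, h4, h5⟩ := h O hOt
    refine ⟨⟨O, hO⟩, hxO, h1, h2, h5 ⟨O, hO⟩ subset_rfl, ?_⟩
    rintro i ⟨y, hyO, hyi⟩
    refine h4 i ?_ ⟨O, hO⟩ subset_rfl
    by_contra hxi
    exact Set.mem_iInter₂.1 (h3 hyO) i hxi (subset_closure hyi)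
  choose V hxV hVU hVw hVx hVi using key
  let V' : PointCover X := ⟨V, hxV⟩
  have hUV : U ≤ V' := hVU
  refine ⟨V', hUV, ?_⟩
  have : ∀ s : Fin 2 → X, ∃ b : B.obj (op (V'.inter s)),
      (g.app _).hom b = refine C hUV 1 γ s := by
    intro s
    -- The third lift below needs a point of the overlap, to see that `V (s 0)` meets `w (τ (s 1))`.
    -- On an empty overlap there is nothing to lift.
    by_cases hs : V'.inter s = ⊥
    · have : Subsingleton (C.obj (op (V'.inter s))) := by rwa [hs]
      exact ⟨0, Subsingleton.elim _ _⟩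
    obtain ⟨y, hy⟩ := (Opens.ne_bot_iff_nonempty _).1 hs
    have h0 : V'.inter s ≤ V (s 0) := V'.inter_le s 0
    have h1 : V'.inter s ≤ V (s 1) := V'.inter_le s 1
    obtain ⟨k1, b1, hb1⟩ := lift_mono (hVx (s 0)) h0
    obtain ⟨k2, b2, hb2⟩ := lift_mono (hVx (s 1)) h1
    obtain ⟨k3, b3, hb3⟩ := lift_mono (hVi (s 0) (τ (s 1)) ⟨y, h0 hy, hVw _ (h1 hy)⟩) h0
    -- With `i = τ (s 0)` and `j = τ (s 1)`, two cocycle relations give `γ (s 0, s 1) = γ (i, j) + γ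
    -- (j, s 1) - γ (i, s 0)`, and each term on the right has a lift.
    refine ⟨b3 + b2 - b1, ?_⟩
    have u0 : V'.inter s ≤ U.set (s 0) := h0.trans (hVU _)
    have u1 : V'.inter s ≤ U.set (s 1) := h1.trans (hVU _)
    have u2 : V'.inter s ≤ U.set (τ (s 0)) := k1.trans (U.inter_le _ 0)
    have u3 : V'.inter s ≤ U.set (τ (s 1)) := k2.trans (U.inter_le _ 0)
    have r1 := cocycle_relation γ.2 u2 u0 u1
    have r2 := cocycle_relation γ.2 u2 u3 u1
    have e : refine C hUV 1 γ s = res C (PointCover.le_inter_pair u0 u1) (γ.1 ![s 0, s 1]) := by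
      refine res_cochain_congr γ.1 ?_ _ _
      funext i
      fin_cases i <;> rfl
    rw [map_sub, map_add, hb1, hb2, hb3, e, ← r2, r1, add_sub_cancel_left]
  choose b hb using this
  exact ⟨b, funext hb⟩

/-- On a paracompact Hausdorff space, the connecting homomorphism is defined on all of `H¹`. -/
theorem IsConnecting.exists [T2Space X] [ParacompactSpace X] (hfg : IsLeftExact f g)
    (hg : IsLocallySurjective g) [Subsingleton (C.obj (op ⊥))] {U : PointCover X}
    (γ : cocycles C U 1) : ∃ a, IsConnecting f g 1 (cechClass C U 1 γ) a := by
  obtain ⟨V, h, b, hb⟩ := hg.exists_lift_one γ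
  have hker : mapCochain g V 2 (d B V 1 b) = 0 := by
    rw [mapCochain_d, hb, d_refine, show d C U 1 γ = 0 from γ.2, map_zero]
  obtain ⟨α, hα⟩ := hfg.exists_mapCochain hker
  have hα' : α ∈ cocycles A V 2 := by
    refine hfg.mapCochain_injective _ _ ?_
    rw [mapCochain_d, hα, d_d_one, map_zero]
  exact ⟨_, V, refineCocycles C h 1 γ, b, ⟨α, hα'⟩, cechClass_refine h γ, hb, hα, rfl⟩

end Connecting


/-! ### Exactness of the exponential sequence -/

section ExpExact

variable {X : Type u} [TopologicalSpace X]

/-- For exactness in the middle: if `exp b = 1`, then `b / 2πi` is continuous and integer-valued,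
hence constant along each connected fibre `{x} × ℂ`, and so descends to a locally constant function
on `U`. -/
theorem isLeftExact_exp : IsLeftExact (twoPiI X) (expMap X) where
  injective U a b h := by
    change LocallyConstant U ℤ at a b
    refine LocallyConstant.ext fun x => ?_
    have h' : 2 * Real.pi * Complex.I * (a x : ℂ) = 2 * Real.pi * Complex.I * (b x : ℂ) :=
      congrFun (congrArg Subtype.val h) (x, 0)
    exact Int.cast_injective (mul_left_cancel₀ Complex.two_pi_I_ne_zero h')
  comp_eq_zero U a := by
    change LocallyConstant U ℤ at a
    refine congrArg Additive.ofMul (Units.ext (Subtype.ext (funext fun p => ?_)))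
    change Complex.exp (2 * Real.pi * Complex.I * (a p.1 : ℂ)) = 1
    exact Complex.exp_eq_one_iff.2 ⟨a p.1, mul_comm _ _⟩
  exists_of_eq_zero U b h := by
    have hb : ∀ p, Complex.exp (b.1 p) = 1 := fun p =>
      congrFun (congrArg Subtype.val (congrArg Units.val
        (show expUnit b = 1 from h))) p
    choose n hn using fun p => Complex.exp_eq_one_iff.1 (hb p)
    have hcont : Continuous n := by
      rw [Int.isClosedEmbedding_coe_real.isEmbedding.continuous_iff]
      have : (fun p => ((n p : ℤ) : ℝ)) = fun p => (b.1 p / (2 * Real.pi * Complex.I)).re := by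
        funext p
        rw [hn p, mul_div_cancel_right₀ _ Complex.two_pi_I_ne_zero, Complex.intCast_re]
      change Continuous fun p => ((n p : ℤ) : ℝ)
      rw [this]
      exact Complex.continuous_re.comp (b.2.1.div_const _)
    refine ⟨⟨fun x => n (x, 0), (IsLocallyConstant.iff_continuous _).2
      (hcont.comp (continuous_id.prodMk continuous_const))⟩, Subtype.ext (funext fun p => ?_)⟩
    have hz : n (p.1, 0) = n p := PreconnectedSpace.constant (Y := ℤ) (f := fun z : ℂ => n (p.1, z))
      inferInstance (hcont.comp (continuous_const.prodMk continuous_id))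
    change 2 * Real.pi * Complex.I * (n (p.1, 0) : ℂ) = b.1 p
    rw [hz, hn p, mul_comm]

/-- A continuous logarithm of an entire function is entire. -/
theorem differentiable_of_exp_eq {b h : ℂ → ℂ} (hb : Continuous b) (hh : Differentiable ℂ h)
    (e : ∀ z, Complex.exp (b z) = h z) : Differentiable ℂ b := by
  intro z₀
  have h0 : h z₀ ≠ 0 := e z₀ ▸ Complex.exp_ne_zero _
  -- Where the imaginary part of `b z - b z₀` stays below `π` in absolute value, the principal
  -- logarithm of `h z / h z₀` recovers that difference.
  have ev : ∀ᶠ z in nhds z₀, b z = b z₀ + Complex.log (h z / h z₀) := by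
    have : ∀ᶠ z in nhds z₀, |(b z - b z₀).im| < Real.pi := by
      have hc : Continuous fun z => |(b z - b z₀).im| :=
        (Complex.continuous_im.comp (hb.sub continuous_const)).abs
      exact hc.continuousAt.eventually_lt continuousAt_const (by simp [Real.pi_pos])
    filter_upwards [this] with z hz
    rw [← e z, ← e z₀, ← Complex.exp_sub, Complex.log_exp (abs_lt.1 hz).1 (abs_lt.1 hz).2.le]
    ring
  refine DifferentiableAt.congr_of_eventuallyEq ?_ ev
  refine DifferentiableAt.const_add _ (((hh z₀).div_const _).clog ?_)
  rw [div_self h0]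
  exact Complex.one_mem_slitPlane

/-- Nowhere vanishing entire families have logarithms over small open sets. -/
theorem isLocallySurjective_exp : IsLocallySurjective (expMap X) := by
  intro U c x₀ hx₀
  let h : entireFamilies U := ((Additive.toMul (c : Additive (entireFamilies U)ˣ)) : _ˣ)
  have hne : ∀ p, h.1 p ≠ 0 := (isUnit_iff_ne_zero h).1 (Units.isUnit _)
  let a := h.1 (⟨x₀, hx₀⟩, 0)
  -- Over `T` the principal branch gives a logarithm along the zero section `z = 0`.
  let T : Set U := {x | h.1 (x, 0) / a ∈ Complex.slitPlane}
  have hT : IsOpen T := Complex.isOpen_slitPlane.preimage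
    ((h.2.1.comp (continuous_id.prodMk continuous_const)).div_const a)
  let V : Opens X := ⟨Subtype.val '' T, U.2.isOpenMap_subtype_val _ hT⟩
  have hVU : V ≤ U := by
    rintro _ ⟨x, -, rfl⟩
    exact x.2
  have hVT : ∀ x : V, h.1 (Set.inclusion hVU x, 0) / a ∈ Complex.slitPlane := by
    rintro ⟨_, x, hx, rfl⟩
    exact hx
  let k := restrict hVU h
  have kcont : Continuous k.1 := k.2.1
  have kne : ∀ p, k.1 p ≠ 0 := fun p => hne _
  let f : C(V × ℂ, ℂ) := ⟨fun p => Complex.log a + Complex.log (k.1 (p.1, 0) / a),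
    continuous_const.add (Continuous.clog ((kcont.comp
      (continuous_fst.prodMk continuous_const)).div_const a) fun p => hVT p.1)⟩
  -- The radial contraction `(t, x, z) ↦ k (x, t z)` joins the zero section to `k`. Lifting this
  -- homotopy through the covering `exp`, from the logarithm `f` at `t = 0`, yields a continuous
  -- logarithm of `k` at `t = 1`.
  let H : C(unitInterval × (V × ℂ), {z : ℂ // z ≠ 0}) :=
    ⟨fun q => ⟨k.1 (q.2.1, (q.1 : ℝ) * q.2.2), kne _⟩, by
      refine Continuous.subtype_mk (kcont.comp ?_) _
      fun_prop⟩
  have hH : ∀ p, H (0, p) = ⟨Complex.exp (f p), Complex.exp_ne_zero _⟩ := by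
    intro p
    refine Subtype.ext ?_
    change k.1 (p.1, ((0 : ℝ) : ℂ) * p.2) = Complex.exp (_ + _)
    rw [Complex.exp_add, Complex.exp_log (hne _), Complex.exp_log (div_ne_zero (kne _) (hne _)),
      mul_div_cancel₀ _ (hne _), Complex.ofReal_zero, zero_mul]
  let L := Complex.isCoveringMap_exp.liftHomotopy H f hH
  have hL : ∀ p, Complex.exp (L (1, p)) = k.1 p := by
    intro p
    have := congrArg Subtype.val
      (congrFun (Complex.isCoveringMap_exp.liftHomotopy_lifts H f hH) (1, p))
    refine this.trans ?_
    change k.1 (p.1, ((1 : ℝ) : ℂ) * p.2) = k.1 p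
    rw [Complex.ofReal_one, one_mul]
  have hLc : Continuous fun p => L (1, p) := L.continuous.comp (continuous_const.prodMk continuous_id)
  refine ⟨V, hVU, ⟨fun p => L (1, p), hLc, fun x => ?_⟩, ⟨⟨x₀, hx₀⟩, ?_, rfl⟩, ?_⟩
  · exact differentiable_of_exp_eq (hLc.comp (continuous_const.prodMk continuous_id)) (k.2.2 x)
      fun z => hL (x, z)
  · change a / a ∈ Complex.slitPlane
    rw [div_self (hne _)]
    exact Complex.one_mem_slitPlane
  · exact congrArg Additive.ofMul (Units.ext (Subtype.ext (funext hL)))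

instance : Subsingleton ((sheafOUnits X).obj (op ⊥)) := by
  refine ⟨fun a b => ?_⟩
  change Additive (entireFamilies (⊥ : Opens X))ˣ at a b
  exact congrArg Additive.ofMul (Units.ext (Subtype.ext (funext fun p => p.1.2.elim)))

end ExpExact

/-! ### Vanishing of `H¹(X; 𝒪)` -/

section Vanishing

variable {X : Type u} [TopologicalSpace X]

/-- The value of a cochain of `𝒪`, extended by zero. -/
def extendZero {U : Opens X} (h : entireFamilies U) (p : X × ℂ) : ℂ :=
  open Classical in if hp : p.1 ∈ U then h.1 (⟨p.1, hp⟩, p.2) else 0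

theorem extendZero_of_mem {U : Opens X} (h : entireFamilies U) {p : X × ℂ} (hp : p.1 ∈ U) :
    extendZero h p = h.1 (⟨p.1, hp⟩, p.2) := dif_pos hp

theorem extendZero_of_notMem {U : Opens X} (h : entireFamilies U) {p : X × ℂ} (hp : p.1 ∉ U) :
    extendZero h p = 0 := dif_neg hp

theorem continuousOn_extendZero {U : Opens X} (h : entireFamilies U) :
    ContinuousOn (extendZero h) {p | p.1 ∈ U} := by
  rw [continuousOn_iff_continuous_domRestrict]
  have : Set.domRestrict {p : X × ℂ | p.1 ∈ U} (extendZero h) =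
      fun p => h.1 (⟨p.1.1, p.2⟩, p.1.2) := funext fun p => extendZero_of_mem h p.2
  rw [this]
  exact h.2.1.comp (by fun_prop)

theorem differentiable_extendZero {U : Opens X} (h : entireFamilies U) (x : X) :
    Differentiable ℂ fun z => extendZero h (x, z) := by
  by_cases hx : x ∈ U
  · have : (fun z => extendZero h (x, z)) = fun z => h.1 (⟨x, hx⟩, z) :=
      funext fun z => extendZero_of_mem h hx
    rw [this]
    exact h.2.2 _
  · have : (fun z => extendZero h (x, z)) = fun _ => 0 :=
      funext fun z => extendZero_of_notMem h hx
    rw [this]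
    exact differentiable_const _

/-- On a paracompact Hausdorff space every `1`-cocycle of `𝒪` is a coboundary. -/
theorem exists_d_eq_of_mem_cocycles_sheafO [T2Space X] [ParacompactSpace X] {U : PointCover X}
    {c : Cochain (sheafO X) U 1} (hc : c ∈ cocycles (sheafO X) U 1) :
    ∃ e, d (sheafO X) U 0 e = c := by
  obtain ⟨ρ, hρ⟩ := PartitionOfUnity.exists_isSubordinate isClosed_univ
    (fun x => (U.set x : Set X)) (fun x => (U.set x).2)
    (fun x _ => Set.mem_iUnion.2 ⟨x, U.mem x⟩)
  let c' : ∀ t : Fin 2 → X, entireFamilies (U.inter t) := c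
  let E : X → X → X × ℂ → ℂ := fun x y => extendZero (c' ![x, y])
  -- The primitive is `e y = ∑ₓ ρ x · c (x, y)`. Since `ρ` depends only on the base point, the sum
  -- stays entire in `z`.
  let T : X → X → X × ℂ → ℂ := fun x y p => (ρ x p.1 : ℂ) * E x y p
  have hmem : ∀ {x y z : X}, z ∈ U.set x → z ∈ U.set y → z ∈ U.inter ![x, y] := fun hx hy =>
    PointCover.mem_inter.2 fun i => by fin_cases i <;> assumption
  have hfin : ∀ z, (Function.support fun x => ρ x z).Finite := fun z =>
    ρ.locallyFinite.point_finite z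
  have hsum : ∀ y p, ∑ᶠ x, T x y p = ∑ x ∈ (hfin p.1).toFinset, T x y p := fun y p =>
    finsum_eq_sum_of_support_subset _ fun x hx => by
      rw [Set.Finite.coe_toFinset]
      intro h0
      exact hx (by simp [T, h0])
  have hcont : ∀ y, Continuous fun p : U.set y × ℂ => ∑ᶠ x, T x y (p.1, p.2) := by
    intro y
    refine continuous_finsum (fun x => ?_) ?_
    · refine continuous_iff_continuousAt.2 fun p => ?_
      by_cases hp : (p.1 : X) ∈ U.set x
      · have h1 : ContinuousAt (E x y) (p.1, p.2) :=
          (continuousOn_extendZero _).continuousAt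
            (((U.inter ![x, y]).2.preimage continuous_fst).mem_nhds (hmem hp p.1.2))
        have h2 : Continuous fun p : U.set y × ℂ => ((p.1 : X), p.2) := by fun_prop
        refine ContinuousAt.mul ?_ (ContinuousAt.comp (f := fun p : U.set y × ℂ => ((p.1 : X), p.2))
          h1 h2.continuousAt)
        exact (Complex.continuous_ofReal.comp ((ρ x).continuous.comp
          (continuous_subtype_val.comp continuous_fst))).continuousAt
      -- Extension by zero may jump at the boundary of `U.set x`, but `ρ x` vanishes near every
      -- point outside `U.set x`.
      · have h1 : (p.1 : X) ∉ tsupport (ρ x) := fun h => hp (hρ x h)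
        have h2 : ∀ᶠ q : U.set y × ℂ in nhds p, T x y (q.1, q.2) = 0 := by
          have := (continuous_subtype_val.comp continuous_fst :
            Continuous fun q : U.set y × ℂ => (q.1 : X)).continuousAt.eventually
            (notMem_tsupport_iff_eventuallyEq.1 h1)
          filter_upwards [this] with q hq
          have hq' : ρ x q.1 = 0 := hq
          simp [T, hq']
        exact (continuousAt_const (y := (0 : ℂ))).congr (h2.mono fun _ h => h.symm)
    · refine (ρ.locallyFinite.preimage_continuous
        (continuous_subtype_val.comp continuous_fst :
          Continuous fun q : U.set y × ℂ => (q.1 : X))).subset fun x q hq h0 => ?_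
      refine hq ?_
      have h0' : ρ x q.1 = 0 := h0
      simp [T, h0']
  have hdiff : ∀ y (z : U.set y), Differentiable ℂ fun w => ∑ᶠ x, T x y (z, w) := by
    intro y z
    simp only [hsum]
    exact Differentiable.fun_sum (u := (hfin z).toFinset) fun x _ =>
      (differentiable_extendZero (c' ![x, y]) z).const_mul (ρ x z : ℂ)
  let e : ∀ y, (sheafO X).obj (op (U.set y)) := fun y =>
    (⟨fun p => ∑ᶠ x, T x y (p.1, p.2), hcont y, hdiff y⟩ : entireFamilies (U.set y))
  refine ⟨ofFamily e, ?_⟩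
  funext s
  refine (d_ofFamily e s).trans ?_
  refine Subtype.ext (funext fun p => ?_)
  have m0 : (p.1 : X) ∈ U.set (s 0) := U.inter_le s 0 p.1.2
  have m1 : (p.1 : X) ∈ U.set (s 1) := U.inter_le s 1 p.1.2
  change ∑ᶠ x, T x (s 1) (p.1, p.2) - ∑ᶠ x, T x (s 0) (p.1, p.2) = (c s).1 p
  rw [hsum, hsum, ← Finset.sum_sub_distrib]
  -- The cocycle relation says `c (x, s 1) - c (x, s 0) = c (s 0, s 1)`, independently of `x`;
  -- summing against `ρ`, of total mass 1, returns `c s`.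
  have key : ∀ x ∈ (hfin p.1).toFinset, T x (s 1) (p.1, p.2) - T x (s 0) (p.1, p.2) =
      (ρ x p.1 : ℂ) * (c s).1 p := by
    intro x hx
    have mx : (p.1 : X) ∈ U.set x :=
      hρ x (subset_tsupport _ ((hfin p.1).mem_toFinset.1 hx))
    let V : Opens X := U.set x ⊓ U.set (s 0) ⊓ U.set (s 1)
    have mV : (p.1 : X) ∈ V := ⟨⟨mx, m0⟩, m1⟩
    have r := cocycle_relation hc (V := V) (x := x) (y := s 0) (z := s 1)
      (inf_le_left.trans inf_le_left) (inf_le_left.trans inf_le_right) inf_le_right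
    have r' := congrFun (congrArg Subtype.val r) (⟨p.1, mV⟩, p.2)
    have es : s = ![s 0, s 1] := by
      funext i; fin_cases i <;> rfl
    have es' : (c s).1 p = E (s 0) (s 1) (p.1, p.2) := by
      have : extendZero (c' s) (p.1, p.2) = (c s).1 p := extendZero_of_mem (c' s) p.1.2
      rw [← this]
      exact congrArg (fun t => extendZero (c' t) ((p.1 : X), p.2)) es
    have r'' : E x (s 1) (p.1, p.2) = E x (s 0) (p.1, p.2) + E (s 0) (s 1) (p.1, p.2) := by
      have e1 : E x (s 1) (p.1, p.2) = _ := extendZero_of_mem (c' ![x, s 1]) (hmem mx m1)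
      have e2 : E x (s 0) (p.1, p.2) = _ := extendZero_of_mem (c' ![x, s 0]) (hmem mx m0)
      have e3 : E (s 0) (s 1) (p.1, p.2) = _ := extendZero_of_mem (c' ![s 0, s 1]) (hmem m0 m1)
      rw [e1, e2, e3]
      exact r'
    rw [es']
    simp only [T, r'']
    ring
  rw [Finset.sum_congr rfl key, ← Finset.sum_mul, ← Complex.ofReal_sum]
  have h1 : ∑ x ∈ (hfin p.1).toFinset, ρ x p.1 = 1 := by
    rw [← ρ.sum_eq_one (Set.mem_univ (p.1 : X))]
    exact (finsum_eq_sum_of_support_subset _ (by rw [Set.Finite.coe_toFinset])).symm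
  rw [h1, Complex.ofReal_one, one_mul]

end Vanishing


/-! ### Ratios of entire functions with the same simple zeros -/

section Ratio

/-- The quotient `f / g` of two entire functions with the same simple zeros, with the singularities
removed. -/
def ratio (f g : ℂ → ℂ) (z : ℂ) : ℂ :=
  open Classical in if g z = 0 then deriv f z / deriv g z else f z / g z

variable {f g : ℂ → ℂ}

theorem ratio_mul (hfg : ∀ z, g z = 0 → f z = 0) (z : ℂ) : ratio f g z * g z = f z := by
  by_cases h : g z = 0
  · rw [h, mul_zero, hfg z h]
  · rw [ratio, if_neg h, div_mul_cancel₀ _ h]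

theorem ratio_ne_zero (hfg : ∀ z, f z = 0 → g z = 0) (hf : ∀ z, f z = 0 → deriv f z ≠ 0)
    (hg : ∀ z, g z = 0 → deriv g z ≠ 0) (hgf : ∀ z, g z = 0 → f z = 0) (z : ℂ) :
    ratio f g z ≠ 0 := by
  by_cases h : g z = 0
  · rw [ratio, if_pos h]
    exact div_ne_zero (hf z (hgf z h)) (hg z h)
  · rw [ratio, if_neg h]
    exact div_ne_zero (fun h' => h (hfg z h')) h

/-- Near a zero `a` of `g`, both functions are `z - a` times their `dslope`, and `dslope g a a =
deriv g a` is nonzero; the ratio is the quotient of the slopes, at `a` included. -/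
theorem differentiable_ratio (hf : Differentiable ℂ f) (hg : Differentiable ℂ g)
    (hfg : ∀ z, g z = 0 → f z = 0) (hg' : ∀ z, g z = 0 → deriv g z ≠ 0) :
    Differentiable ℂ (ratio f g) := by
  intro a
  by_cases h : g a = 0
  · have df : DifferentiableAt ℂ (dslope f a) a :=
      ((Complex.differentiableOn_dslope Filter.univ_mem).2 hf.differentiableOn).differentiableAt
        Filter.univ_mem
    have dg : DifferentiableAt ℂ (dslope g a) a :=
      ((Complex.differentiableOn_dslope Filter.univ_mem).2 hg.differentiableOn).differentiableAt
        Filter.univ_mem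
    have ne : dslope g a a ≠ 0 := by
      rw [dslope_same]
      exact hg' a h
    refine (df.div dg ne).congr_of_eventuallyEq ?_
    filter_upwards [dg.continuousAt.eventually_ne ne] with z hz
    by_cases hza : z = a
    · subst hza
      simp only [ratio, if_pos h, Pi.div_apply, dslope_same]
    · have eg : (z - a) * dslope g a z = g z := by
        have := sub_smul_dslope g a z
        rwa [h, sub_zero, smul_eq_mul] at this
      have ef : (z - a) * dslope f a z = f z := by
        have := sub_smul_dslope f a z
        rwa [hfg a h, sub_zero, smul_eq_mul] at this
      have hgz : g z ≠ 0 := eg ▸ mul_ne_zero (sub_ne_zero.2 hza) hz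
      rw [ratio, if_neg hgz, ← ef, ← eg, mul_div_mul_left _ _ (sub_ne_zero.2 hza)]
      rfl
  · refine ((hf a).div (hg a) h).congr_of_eventuallyEq ?_
    filter_upwards [(hg a).continuousAt.eventually_ne h] with z hz
    rw [ratio, if_neg hz]
    rfl

open Topology in
/-- A family of entire functions which is continuous along a circle is continuous at its centre. -/
theorem continuousAt_of_continuousAt_sphere {Y : Type*} [TopologicalSpace Y] {H : Y × ℂ → ℂ}
    (hd : ∀ y, Differentiable ℂ fun z => H (y, z)) {y₀ : Y} {z₀ : ℂ} {r : ℝ} (hr : 0 < r)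
    (hc : ∀ ζ ∈ Metric.sphere z₀ r, ContinuousAt H (y₀, ζ)) : ContinuousAt H (y₀, z₀) := by
  rw [Metric.continuousAt_iff']
  intro ε hε
  -- Compactness of the circle makes the estimate uniform in `ζ`; the maximum principle in `h4`
  -- carries it into the disc.
  have h1 : ∀ᶠ y in 𝓝 y₀, ∀ ζ ∈ Metric.sphere z₀ r, ‖H (y, ζ) - H (y₀, ζ)‖ < ε / 2 := by
    refine (isCompact_sphere z₀ r).eventually_forall_of_forall_eventually fun ζ hζ => ?_
    have a1 : ContinuousAt (fun q : Y × ℂ => H (y₀, q.2)) (y₀, ζ) :=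
      ((hd y₀).continuous.comp continuous_snd).continuousAt
    have a2 : ContinuousAt (fun q : Y × ℂ => ‖H (q.1, q.2) - H (y₀, q.2)‖) (y₀, ζ) :=
      ((hc ζ hζ).sub a1).norm
    exact a2.eventually_lt continuousAt_const (by simpa using half_pos hε)
  have h2 : ∀ᶠ z in 𝓝 z₀, ‖H (y₀, z) - H (y₀, z₀)‖ < ε / 2 := by
    have : Continuous fun z => ‖H (y₀, z) - H (y₀, z₀)‖ :=
      ((hd y₀).continuous.sub continuous_const).norm
    exact this.continuousAt.eventually_lt continuousAt_const (by simpa using half_pos hε)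
  have h3 := h1.prod_nhds (h2.and (Metric.ball_mem_nhds z₀ hr))
  filter_upwards [h3] with ⟨y, z⟩ ⟨hy, hz, hzr⟩
  have h4 : ‖H (y, z) - H (y₀, z)‖ ≤ ε / 2 := by
    refine Complex.norm_le_of_forall_mem_frontier_norm_le (f := fun z => H (y, z) - H (y₀, z))
      (Metric.isBounded_ball (x := z₀) (r := r)) ((hd y).sub (hd y₀)).diffContOnCl
      (fun ζ hζ => ?_) (subset_closure hzr)
    rw [frontier_ball z₀ hr.ne'] at hζ
    exact (hy ζ hζ).le
  rw [dist_eq_norm]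
  calc ‖H (y, z) - H (y₀, z₀)‖ = ‖(H (y, z) - H (y₀, z)) + (H (y₀, z) - H (y₀, z₀))‖ := by
        congr 1; ring
    _ ≤ ‖H (y, z) - H (y₀, z)‖ + ‖H (y₀, z) - H (y₀, z₀)‖ := norm_add_le _ _
    _ < ε := by linarith

end Ratio

/-! ### Ratios of local realizations -/

section Realization

variable {X : Type u} [TopologicalSpace X] {E : Set (X × ℂ)}

theorem IsLocalRealization.restrict {U V : Opens X} (h : V ≤ U) {F : entireFamilies U}
    (hF : IsLocalRealization E U F) : IsLocalRealization E V (restrict h F) :=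
  fun x z => hF (Set.inclusion h x) z

-- Simple zeros are isolated. This supplies the zero-free circles in `exists_unit` and the density
-- argument in `mul_right_cancel`.
open Topology in
theorem IsLocalRealization.eventually_ne {U : Opens X} {F : entireFamilies U}
    (hF : IsLocalRealization E U F) (x : U) (z : ℂ) : ∀ᶠ w in 𝓝[≠] z, F.1 (x, w) ≠ 0 := by
  by_cases h : F.1 (x, z) = 0
  · exact (F.2.2 x z).hasDerivAt.eventually_ne ((hF x z).2 h)
  · exact nhdsWithin_le_nhds ((F.2.2 x z).continuousAt.eventually_ne h)

/-- A local realization is a non-zero-divisor. -/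
theorem IsLocalRealization.mul_right_cancel {U : Opens X} {F : entireFamilies U}
    (hF : IsLocalRealization E U F) {a b : entireFamilies U} (h : a * F = b * F) : a = b := by
  refine Subtype.ext (funext fun p => ?_)
  have hd : Dense {w | F.1 (p.1, w) ≠ 0} := fun z =>
    mem_closure_iff_frequently.2
      ((hF.eventually_ne p.1 z).frequently.filter_mono nhdsWithin_le_nhds)
  refine congrFun (Continuous.ext_on hd (a.2.2 p.1).continuous (b.2.2 p.1).continuous
    fun w hw => ?_) p.2
  exact mul_right_cancel₀ hw (congrFun (congrArg Subtype.val h) (p.1, w))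

/-- Two local realizations differ by a unit of `𝒪`. -/
theorem IsLocalRealization.exists_unit {U : Opens X} {F G : entireFamilies U}
    (hF : IsLocalRealization E U F) (hG : IsLocalRealization E U G) :
    ∃ h : (entireFamilies U)ˣ, F = h * G := by
  let H : U × ℂ → ℂ := fun p => ratio (fun z => F.1 (p.1, z)) (fun z => G.1 (p.1, z)) p.2
  have hGF : ∀ x z, G.1 (x, z) = 0 → F.1 (x, z) = 0 := fun x z h =>
    (hF x z).1.2 ((hG x z).1.1 h)
  have hFG : ∀ x z, F.1 (x, z) = 0 → G.1 (x, z) = 0 := fun x z h =>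
    (hG x z).1.2 ((hF x z).1.1 h)
  have hd : ∀ x, Differentiable ℂ fun z => H (x, z) := fun x =>
    differentiable_ratio (F.2.2 x) (G.2.2 x) (hGF x) fun z => (hG x z).2
  have hne : ∀ p, H p ≠ 0 := fun p =>
    ratio_ne_zero (hFG p.1) (fun z => (hF p.1 z).2) (fun z => (hG p.1 z).2) (hGF p.1) p.2
  have hc : ∀ p, G.1 p ≠ 0 → ContinuousAt H p := by
    intro p hp
    refine ((F.2.1.continuousAt (x := p)).div G.2.1.continuousAt hp).congr ?_
    filter_upwards [(G.2.1.continuousAt (x := p)).eventually_ne hp] with q hq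
    exact (if_neg hq).symm
  have hcont : Continuous H := by
    refine continuous_iff_continuousAt.2 fun ⟨x, z⟩ => ?_
    obtain ⟨r, hr, h⟩ := Metric.mem_nhdsWithin_iff.1 (hG.eventually_ne x z)
    refine continuousAt_of_continuousAt_sphere hd (half_pos hr) fun ζ hζ => hc _ (h ⟨?_, ?_⟩)
    · rw [Metric.mem_ball, Metric.mem_sphere.1 hζ]
      exact half_lt_self hr
    · rintro rfl
      rw [Metric.mem_sphere, dist_self] at hζ
      exact (half_pos hr).ne hζ
  let h : entireFamilies U := ⟨H, hcont, hd⟩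
  refine ⟨((isUnit_iff_ne_zero h).2 hne).unit, Subtype.ext (funext fun p => ?_)⟩
  exact (ratio_mul (hGF p.1) p.2).symm

/-- The ring element underlying a section of `𝒪ˣ`. -/
def unitVal {U : Opens X} (a : (sheafOUnits X).obj (op U)) : entireFamilies U :=
  ((Additive.toMul (a : Additive (entireFamilies U)ˣ) : (entireFamilies U)ˣ) : entireFamilies U)

theorem unitVal_injective {U : Opens X} :
    Function.Injective (unitVal : (sheafOUnits X).obj (op U) → entireFamilies U) :=
  fun _ _ h => Additive.toMul.injective (Units.ext h)

theorem unitVal_add {U : Opens X} (a b : (sheafOUnits X).obj (op U)) :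
    unitVal (a + b) = unitVal a * unitVal b := rfl

theorem unitVal_res {U V : Opens X} (h : V ≤ U) (a : (sheafOUnits X).obj (op U)) :
    unitVal (res (sheafOUnits X) h a) = restrict h (unitVal a) := rfl

theorem restrict_restrict {U V W : Opens X} (h : V ≤ U) (k : W ≤ V) (F : entireFamilies U) :
    restrict k (restrict h F) = restrict (k.trans h) F := rfl

theorem isRatioCocycle_iff {U : PointCover X} {F : ∀ x, entireFamilies (U.set x)}
    {h : cocycles (sheafOUnits X) U 1} : IsRatioCocycle U F h ↔
      ∀ s : Fin 2 → X, restrict (U.inter_le s 0) (F (s 0)) =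
        unitVal (h.1 s) * restrict (U.inter_le s 1) (F (s 1)) := Iff.rfl

theorem exists_isRatioCocycle {U : PointCover X} {F : ∀ x, entireFamilies (U.set x)}
    (hF : ∀ x, IsLocalRealization E (U.set x) (F x)) : ∃ h, IsRatioCocycle U F h := by
  choose h hh using fun s : Fin 2 → X => ((hF (s 0)).restrict (U.inter_le s 0)).exists_unit
    ((hF (s 1)).restrict (U.inter_le s 1))
  let c : Cochain (sheafOUnits X) U 1 := fun s => Additive.ofMul (h s)
  have hc : ∀ {x y : X} {V : Opens X} (hx : V ≤ U.set x) (hy : V ≤ U.set y),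
      restrict hx (F x) = unitVal (res (sheafOUnits X) (PointCover.le_inter_pair hx hy)
        (c ![x, y])) * restrict hy (F y) := fun hx hy =>
    congrArg (restrict (PointCover.le_inter_pair hx hy)) (hh ![_, _])
  refine ⟨⟨c, mem_cocycles_one fun s => unitVal_injective ?_⟩, hh⟩
  refine ((hF (s 2)).restrict (U.inter_le s 2)).mul_right_cancel ?_
  rw [unitVal_add, mul_assoc, ← hc (U.inter_le s 0), ← hc (U.inter_le s 1),
    ← hc (U.inter_le s 0)]

/-- The class of the ratios does not depend on the local realizations. -/
theorem IsRatioCocycle.cechClass_eq {U U' : PointCover X} {F : ∀ x, entireFamilies (U.set x)}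
    {F' : ∀ x, entireFamilies (U'.set x)} (hF : ∀ x, IsLocalRealization E (U.set x) (F x))
    (hF' : ∀ x, IsLocalRealization E (U'.set x) (F' x)) {h : cocycles (sheafOUnits X) U 1}
    {h' : cocycles (sheafOUnits X) U' 1} (hh : IsRatioCocycle U F h)
    (hh' : IsRatioCocycle U' F' h') :
    cechClass (sheafOUnits X) U 1 h = cechClass (sheafOUnits X) U' 1 h' := by
  obtain ⟨W, k, k'⟩ := exists_ge_ge U U'
  choose g hg using fun x => ((hF x).restrict (k x)).exists_unit ((hF' x).restrict (k' x))
  let γ : ∀ x, (sheafOUnits X).obj (op (W.set x)) := fun x => Additive.ofMul (g x)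
  have hγ : ∀ x, restrict (k x) (F x) = unitVal (γ x) * restrict (k' x) (F' x) := hg
  rw [← cechClass_refine k, ← cechClass_refine k', ← sub_eq_zero]
  refine (map_sub (cechClass (sheafOUnits X) W 1) _ _).symm.trans ?_
  -- The sign reflects the conventions: `d` yields the value at `s 1` over that at `s 0`, whereas
  -- the ratios are `F (s 0) / F (s 1)`.
  refine cechClass_eq_zero_of_mem ⟨-ofFamily γ, funext fun s => ?_⟩
  rw [map_neg]
  change -d (sheafOUnits X) W 0 (ofFamily γ) s =
    res (sheafOUnits X) (PointCover.inter_mono k s) (h.1 s) -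
      res (sheafOUnits X) (PointCover.inter_mono k' s) (h'.1 s)
  rw [d_ofFamily, neg_sub, sub_eq_sub_iff_add_eq_add]
  refine unitVal_injective
    (((hF' (s 1)).restrict ((W.inter_le s 1).trans (k' _))).mul_right_cancel ?_)
  have e0 := congrArg (restrict (W.inter_le s 0)) (hγ (s 0))
  have e1 := congrArg (restrict (W.inter_le s 1)) (hγ (s 1))
  have f0 := congrArg (restrict (PointCover.inter_mono k s)) (isRatioCocycle_iff.1 hh s)
  have f1 := congrArg (restrict (PointCover.inter_mono k' s)) (isRatioCocycle_iff.1 hh' s)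
  rw [map_mul] at e0 e1 f0 f1
  rw [unitVal_add, unitVal_add, unitVal_res, unitVal_res, unitVal_res, unitVal_res]
  simp only [restrict_restrict] at e0 e1 f0 f1 ⊢
  rw [mul_assoc, ← f1, ← e0, f0, e1, mul_assoc]

end Realization


/-! ### Weierstrass products with parameters -/

section Products

/-- The logarithm of an elementary factor. -/
def logFactor (p : ℕ) (w : ℂ) : ℂ := Complex.log (1 - w) + ∑ k ∈ Finset.Icc 1 p, w ^ k / k

theorem exp_logFactor (p : ℕ) {w : ℂ} (hw : w ≠ 1) :
    Complex.exp (logFactor p w) = elementaryFactor p w := by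
  rw [logFactor, Complex.exp_add, Complex.exp_log (sub_ne_zero.2 hw.symm), elementaryFactor]

theorem elementaryFactor_eq_zero_iff {p : ℕ} {w : ℂ} : elementaryFactor p w = 0 ↔ w = 1 := by
  rw [elementaryFactor, mul_eq_zero, or_iff_left (Complex.exp_ne_zero _), sub_eq_zero, eq_comm]

theorem continuous_elementaryFactor (p : ℕ) : Continuous (elementaryFactor p) := by
  unfold elementaryFactor
  fun_prop

theorem differentiable_elementaryFactor (p : ℕ) : Differentiable ℂ (elementaryFactor p) := by
  unfold elementaryFactor
  fun_prop

theorem differentiableAt_logFactor (p : ℕ) {w : ℂ} (hw : ‖w‖ < 1) :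
    DifferentiableAt ℂ (logFactor p) w := by
  have : 1 - w ∈ Complex.slitPlane := by
    rw [sub_eq_add_neg]
    exact Complex.mem_slitPlane_of_norm_lt_one (by rwa [norm_neg])
  unfold logFactor
  exact (DifferentiableAt.clog (by fun_prop) this).add (by fun_prop)

/-- The sum in `logFactor` cancels the Taylor polynomial of the logarithm up to degree `p`, leaving
the remainder. With `p = n + 1` the bound is a geometric majorant independent of the points `sₙ`. -/
theorem norm_logFactor_le (p : ℕ) {w : ℂ} (hw : ‖w‖ ≤ 1 / 2) : ‖logFactor p w‖ ≤ (1 / 2) ^ p := by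
  have e : logFactor p w = Complex.log (1 + -w) - Complex.logTaylor (p + 1) (-w) := by
    rw [logFactor, ← sub_eq_add_neg, sub_eq_add_neg (Complex.log _)]
    congr 1
    rw [Complex.logTaylor, Finset.sum_range_succ',
      Finset.range_eq_Ico,
      Finset.sum_Ico_add' (fun j : ℕ => (-1 : ℂ) ^ (j + 1) * (-w) ^ j / j) 0 p 1]
    simp only [Nat.cast_zero, div_zero, add_zero, zero_add]
    rw [← Finset.sum_neg_distrib]
    refine Finset.sum_congr rfl fun k _ => ?_
    rw [neg_pow w, ← mul_assoc, ← pow_add, show k + 1 + k = 2 * k + 1 by ring, pow_succ, pow_mul]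
    simp [neg_div]
  rw [e]
  have h1 : ‖-w‖ < 1 := by rw [norm_neg]; linarith
  refine (Complex.norm_log_sub_logTaylor_le p h1).trans ?_
  rw [norm_neg]
  have h2 : (1 - ‖w‖)⁻¹ ≤ 2 := by
    rw [inv_le_comm₀ (by linarith) two_pos]
    linarith
  calc ‖w‖ ^ (p + 1) * (1 - ‖w‖)⁻¹ / (p + 1) ≤ ‖w‖ ^ (p + 1) * (1 - ‖w‖)⁻¹ :=
        div_le_self (mul_nonneg (by positivity) (inv_nonneg.2 (by linarith)))
          (by linarith [p.cast_nonneg (α := ℝ)])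
    _ ≤ (1 / 2) ^ (p + 1) * 2 :=
        mul_le_mul (pow_le_pow_left₀ (norm_nonneg _) hw _) h2 (inv_nonneg.2 (by linarith))
          (by positivity)
    _ = (1 / 2) ^ p := by rw [pow_succ]; ring

variable {Y : Type*} [TopologicalSpace Y]

/-- Near a disc which contains only finitely many of the `sₙ`, a Weierstrass product is a finite
product times the exponential of a family of holomorphic functions. -/
theorem exists_finite_mul_exp {s : ℕ → Y → ℂ} (hs : ∀ n, Continuous (s n)) {c : ℂ} {V : Set Y}
    {S : Finset ℕ} {R : ℝ} (hR : 0 < R) (hS : ∀ n ∉ S, ∀ y ∈ V, 2 * R ≤ ‖s n y - c‖) :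
    ∃ g : Y × ℂ → ℂ, ContinuousOn g (V ×ˢ Metric.ball c R) ∧
      (∀ y ∈ V, DifferentiableOn ℂ (fun z => g (y, z)) (Metric.ball c R)) ∧
      ∀ y ∈ V, ∀ z ∈ Metric.ball c R,
        HasProd (fun n => elementaryFactor (n + 1) ((z - c) / (s n y - c)))
          ((∏ n ∈ S, elementaryFactor (n + 1) ((z - c) / (s n y - c))) *
            Complex.exp (g (y, z))) := by
  classical
  -- Indices in `S`, whose factors may vanish, are set to 0 here and enter through the finite
  -- product. For the others the bound `2 * R` forces the argument into the disc of radius 1/2.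
  let f : ℕ → Y × ℂ → ℂ := fun n p =>
    if n ∈ S then 0 else logFactor (n + 1) ((p.2 - c) / (s n p.1 - c))
  have hw : ∀ n ∉ S, ∀ y ∈ V, ∀ z ∈ Metric.ball c R, ‖(z - c) / (s n y - c)‖ ≤ 1 / 2 := by
    intro n hn y hy z hz
    have h1 := hS n hn y hy
    have h2 : ‖z - c‖ < R := by rwa [← dist_eq_norm]
    rw [norm_div, div_le_iff₀ (by linarith)]
    linarith
  have hne : ∀ n ∉ S, ∀ y ∈ V, s n y - c ≠ 0 := by
    intro n hn y hy h0
    have h1 := hS n hn y hy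
    rw [h0, norm_zero] at h1
    linarith
  have hu : Summable fun n : ℕ => (1 / 2 : ℝ) ^ (n + 1) :=
    (summable_nat_add_iff 1).2 summable_geometric_two
  have hb : ∀ n p, p ∈ V ×ˢ Metric.ball c R → ‖f n p‖ ≤ (1 / 2) ^ (n + 1) := by
    rintro n p ⟨hy, hz⟩
    by_cases hn : n ∈ S
    · simp only [f, if_pos hn, norm_zero]
      positivity
    · simp only [f, if_neg hn]
      exact norm_logFactor_le _ (hw n hn _ hy _ hz)
  refine ⟨fun p => ∑' n, f n p, continuousOn_tsum (fun n => ?_) hu hb, fun y hy => ?_,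
    fun y hy z hz => ?_⟩
  · by_cases hn : n ∈ S
    · simp only [f, if_pos hn]
      exact continuousOn_const
    · simp only [f, if_neg hn]
      rintro p ⟨hy, hz⟩
      refine ContinuousAt.continuousWithinAt ?_
      refine ContinuousAt.comp (f := fun p : Y × ℂ => (p.2 - c) / (s n p.1 - c))
        (differentiableAt_logFactor _ ((hw n hn _ hy _ hz).trans_lt (by norm_num))).continuousAt ?_
      have h1 := (hs n).comp (continuous_fst : Continuous (Prod.fst : Y × ℂ → Y))
      exact (continuous_snd.sub continuous_const).continuousAt.div
        (h1.sub continuous_const).continuousAt (hne n hn _ hy)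
  · refine Complex.differentiableOn_tsum_of_summable_norm hu (fun n => ?_) Metric.isOpen_ball
      fun n z hz => hb n (y, z) ⟨hy, hz⟩
    by_cases hn : n ∈ S
    · simp only [f, if_pos hn]
      exact differentiableOn_const _
    · simp only [f, if_neg hn]
      intro z hz
      refine DifferentiableAt.differentiableWithinAt ?_
      exact DifferentiableAt.comp (f := fun z : ℂ => (z - c) / (s n y - c)) z
        (differentiableAt_logFactor _ ((hw n hn _ hy _ hz).trans_lt (by norm_num))) (by fun_prop)
  · have h1 : HasProd (fun n => if n ∈ S then
        elementaryFactor (n + 1) ((z - c) / (s n y - c)) else 1)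
        (∏ n ∈ S, elementaryFactor (n + 1) ((z - c) / (s n y - c))) := by
      rw [← Finset.prod_congr rfl fun n (hn : n ∈ S) => if_pos (c := n ∈ S) (e := (1 : ℂ)) hn]
      exact hasProd_prod_of_ne_finset_one fun n hn => if_neg hn
    have h2 : Summable fun n => f n (y, z) :=
      Summable.of_norm_bounded hu fun n => hb n (y, z) ⟨hy, hz⟩
    have h3 : (fun n => elementaryFactor (n + 1) ((z - c) / (s n y - c))) = fun n =>
        (if n ∈ S then elementaryFactor (n + 1) ((z - c) / (s n y - c)) else 1) *
          (Complex.exp ∘ fun n => f n (y, z)) n := by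
      funext n
      by_cases hn : n ∈ S
      · simp only [f, if_pos hn, Function.comp_apply, Complex.exp_zero, mul_one]
      · simp only [f, if_neg hn, Function.comp_apply, one_mul]
        refine (exp_logFactor _ fun h => ?_).symm
        have := hw n hn y hy z hz
        rw [h, norm_one] at this
        norm_num at this
    have h4 := h1.mul h2.hasSum.cexp
    rwa [← h3] at h4

/-- If locally in the parameter only finitely many `sₙ` meet a given disc, the Weierstrass product
converges to a continuous family of entire functions. -/
theorem exists_weierstrassProduct {s : ℕ → Y → ℂ} (hs : ∀ n, Continuous (s n)) {c : ℂ}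
    (hne : ∀ n y, s n y ≠ c)
    (hfin : ∀ (y₀ : Y) (R : ℝ), ∃ V ∈ nhds y₀, ∃ S : Finset ℕ, ∀ n ∉ S, ∀ y ∈ V,
      R ≤ ‖s n y - c‖) :
    ∃ F : Y × ℂ → ℂ, Continuous F ∧ (∀ y, Differentiable ℂ fun z => F (y, z)) ∧
      ∀ y z, HasProd (fun n => elementaryFactor (n + 1) ((z - c) / (s n y - c))) (F (y, z)) := by
  let F : Y × ℂ → ℂ := fun p => ∏' n, elementaryFactor (n + 1) ((p.2 - c) / (s n p.1 - c))
  have key : ∀ y₀ z₀, ∃ V ∈ nhds y₀, ∃ B ∈ nhds z₀, ∃ G : Y × ℂ → ℂ, ContinuousAt G (y₀, z₀) ∧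
      DifferentiableAt ℂ (fun z => G (y₀, z)) z₀ ∧ ∀ y ∈ V, ∀ z ∈ B,
      HasProd (fun n => elementaryFactor (n + 1) ((z - c) / (s n y - c))) (G (y, z)) := by
    intro y₀ z₀
    obtain ⟨V, hV, S, hS⟩ := hfin y₀ (2 * (‖z₀ - c‖ + 1))
    have hR : 0 < ‖z₀ - c‖ + 1 := by positivity
    obtain ⟨g, g1, g2, g3⟩ := exists_finite_mul_exp hs hR hS
    have hB : Metric.ball c (‖z₀ - c‖ + 1) ∈ nhds z₀ := Metric.isOpen_ball.mem_nhds (by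
      rw [Metric.mem_ball, dist_eq_norm]; linarith)
    refine ⟨V, hV, _, hB, fun p => (∏ n ∈ S, elementaryFactor (n + 1) ((p.2 - c) / (s n p.1 - c))) *
      Complex.exp (g p), ?_, ?_, g3⟩
    · refine ContinuousAt.mul ?_ (Complex.continuous_exp.continuousAt.comp
        (g1.continuousAt (prod_mem_nhds hV hB)))
      refine Continuous.continuousAt (continuous_finsetProd _ fun n _ =>
        (continuous_elementaryFactor _).comp ?_)
      have h1 := (hs n).comp (continuous_fst : Continuous (Prod.fst : Y × ℂ → Y))
      exact (continuous_snd.sub continuous_const).div (h1.sub continuous_const)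
        fun p => sub_ne_zero.2 (hne n p.1)
    · refine DifferentiableAt.mul ?_ ((g2 y₀ (mem_of_mem_nhds hV)).differentiableAt hB).cexp
      refine DifferentiableAt.fun_finsetProd fun n _ => ?_
      exact DifferentiableAt.comp (f := fun z : ℂ => (z - c) / (s n y₀ - c)) z₀
        (differentiable_elementaryFactor _ _) (by fun_prop)
  refine ⟨F, continuous_iff_continuousAt.2 fun ⟨y₀, z₀⟩ => ?_, fun y₀ z₀ => ?_, fun y z => ?_⟩
  · obtain ⟨V, hV, B, hB, G, h1, -, h3⟩ := key y₀ z₀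
    refine h1.congr ?_
    filter_upwards [prod_mem_nhds hV hB] with ⟨y, z⟩ ⟨hy, hz⟩
    exact (h3 y hy z hz).tprod_eq.symm
  · obtain ⟨V, hV, B, hB, G, -, h2, h3⟩ := key y₀ z₀
    refine h2.congr_of_eventuallyEq ?_
    filter_upwards [hB] with z hz
    exact (h3 y₀ (mem_of_mem_nhds hV) z hz).tprod_eq
  · obtain ⟨V, hV, B, hB, G, -, -, h3⟩ := key y z
    exact (h3 y (mem_of_mem_nhds hV) z (mem_of_mem_nhds hB)).multipliable.hasProd

/-- A Weierstrass product vanishes exactly at the prescribed points, to first order. -/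
theorem weierstrassProduct_simple_zeros {a : ℕ → ℂ} (ha : Function.Injective a) {c : ℂ}
    (hc : ∀ n, a n ≠ c) (hfin : ∀ R : ℝ, {n | ‖a n - c‖ < R}.Finite) {F : ℂ → ℂ}
    (hF : ∀ z, HasProd (fun n => elementaryFactor (n + 1) ((z - c) / (a n - c))) (F z)) (z : ℂ) :
    (F z = 0 ↔ ∃ n, a n = z) ∧ (F z = 0 → deriv F z ≠ 0) := by
  classical
  set R := ‖z - c‖ + 1 with hRdef
  have hR : 0 < R := by positivity
  let S := (hfin (2 * R)).toFinset
  have hS : ∀ n ∉ S, 2 * R ≤ ‖a n - c‖ := fun n hn => by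
    simpa [S] using hn
  obtain ⟨g, -, g2, g3⟩ := exists_finite_mul_exp (Y := Unit) (s := fun n _ => a n) (V := Set.univ)
    (fun n => continuous_const) hR (fun n hn y _ => hS n hn)
  have hzB : z ∈ Metric.ball c R := by
    rw [Metric.mem_ball, dist_eq_norm]; linarith
  have hB : Metric.ball c R ∈ nhds z := Metric.isOpen_ball.mem_nhds hzB
  have hFG : ∀ w ∈ Metric.ball c R, F w =
      (∏ n ∈ S, elementaryFactor (n + 1) ((w - c) / (a n - c))) * Complex.exp (g ((), w)) :=
    fun w hw => (hF w).unique (g3 () trivial w hw)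
  have hfac : ∀ n w, elementaryFactor (n + 1) ((w - c) / (a n - c)) = 0 ↔ a n = w := by
    intro n w
    rw [elementaryFactor_eq_zero_iff, div_eq_one_iff_eq (sub_ne_zero.2 (hc n)), sub_left_inj,
      eq_comm]
  have hzero : F z = 0 ↔ ∃ n ∈ S, a n = z := by
    rw [hFG z hzB, mul_eq_zero, or_iff_left (Complex.exp_ne_zero _), Finset.prod_eq_zero_iff]
    simp only [hfac]
  refine ⟨⟨fun h => ?_, ?_⟩, fun h => ?_⟩
  · obtain ⟨n, -, hn⟩ := hzero.1 h
    exact ⟨n, hn⟩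
  · rintro ⟨n, rfl⟩
    refine hzero.2 ⟨n, ?_, rfl⟩
    by_contra hn
    have := hS n hn
    have := norm_nonneg (a n - c)
    linarith
  · obtain ⟨m, hm, rfl⟩ := hzero.1 h
    -- `K` is the product without the linear factor vanishing at `a m`. Injectivity of `a` gives `K
    -- (a m) ≠ 0`, so that linear factor accounts for the whole zero.
    let K : ℂ → ℂ := fun w =>
      Complex.exp (∑ k ∈ Finset.Icc 1 (m + 1), ((w - c) / (a m - c)) ^ k / k) *
      ((∏ n ∈ S.erase m, elementaryFactor (n + 1) ((w - c) / (a n - c))) *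
        Complex.exp (g ((), w)))
    have hK : DifferentiableAt ℂ K (a m) := by
      refine DifferentiableAt.mul (by fun_prop) (DifferentiableAt.mul ?_
        ((g2 () trivial).differentiableAt hB).cexp)
      refine DifferentiableAt.fun_finsetProd fun n _ => ?_
      exact DifferentiableAt.comp (f := fun z : ℂ => (z - c) / (a n - c)) (a m)
        (differentiable_elementaryFactor _ _) (by fun_prop)
    have hK0 : K (a m) ≠ 0 := by
      refine mul_ne_zero (Complex.exp_ne_zero _) (mul_ne_zero ?_ (Complex.exp_ne_zero _))
      refine Finset.prod_ne_zero_iff.2 fun n hn h0 => ?_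
      exact (Finset.ne_of_mem_erase hn) (ha ((hfac n _).1 h0))
    have hFK : F =ᶠ[nhds (a m)] fun w => (1 - (w - c) / (a m - c)) * K w := by
      filter_upwards [hB] with w hw
      rw [hFG w hw, ← Finset.mul_prod_erase S _ hm, elementaryFactor]
      simp only [K]
      ring
    have h1 : HasDerivAt (fun w => 1 - (w - c) / (a m - c)) (-(1 / (a m - c))) (a m) :=
      (((hasDerivAt_id (a m)).sub_const c).div_const (a m - c)).const_sub 1
    have h2 := (h1.mul hK.hasDerivAt).congr_of_eventuallyEq hFK
    rw [h2.deriv, div_self (sub_ne_zero.2 (hc m)), sub_self, zero_mul, add_zero]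
    exact mul_ne_zero (neg_ne_zero.2 (one_div_ne_zero (sub_ne_zero.2 (hc m)))) hK0

end Products


/-! ### Local sections of an embedded covering -/

section LocalSections

variable {X : Type u} [TopologicalSpace X] {E : Set (X × ℂ)}

/-- Locally, a closed embedded covering is a union of disjoint graphs avoiding a constant, only
finitely many of which meet a given disc. -/
theorem IsClosedEmbeddedCovering.exists_local_sections (hE : IsClosedEmbeddedCovering E) (x₀ : X) :
    ∃ (U : Opens X) (c : ℂ) (s : ℕ → U → ℂ), x₀ ∈ U ∧ (∀ n, Continuous (s n)) ∧
      (∀ x, Function.Injective fun n => s n x) ∧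
      (∀ (x : U) (z : ℂ), ((x : X), z) ∈ E ↔ ∃ n, s n x = z) ∧ (∀ n x, s n x ≠ c) ∧
      ∀ (y₀ : U) (R : ℝ), ∃ V ∈ nhds y₀, ∃ S : Finset ℕ, ∀ n ∉ S, ∀ y ∈ V, R ≤ ‖s n y - c‖ := by
  obtain ⟨hcl, hcov, hfib⟩ := hE
  let f : E → X := fun e => e.1.1
  -- The discrete fibre over `x₀` is countably infinite, so the sheets can be numbered by `ℕ`.
  have hI : IsEvenlyCovered f x₀ ℕ := by
    have h := hcov x₀
    have := h.1
    let φ : {z | (x₀, z) ∈ E} ≃ f ⁻¹' {x₀} :=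
      { toFun := fun z => ⟨⟨(x₀, z.1), z.2⟩, rfl⟩
        invFun := fun e => ⟨e.1.1.2, by
          have h1 : e.1.1 = (x₀, e.1.1.2) := Prod.ext e.2 rfl
          exact h1 ▸ e.1.2⟩
        left_inv := fun z => rfl
        right_inv := fun e => Subtype.ext (Subtype.ext (Prod.ext (Eq.symm e.2) rfl)) }
    have : Countable {z | (x₀, z) ∈ E} := (hfib x₀).1.to_subtype
    have : Infinite {z | (x₀, z) ∈ E} := (hfib x₀).2.to_subtype
    obtain ⟨ψ⟩ := nonempty_equiv_of_countable (α := {z | (x₀, z) ∈ E}) (β := ℕ)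
    exact h.of_fiber_homeomorph ⟨φ.symm.trans ψ, continuous_of_discreteTopology,
      continuous_of_discreteTopology⟩
  obtain ⟨-, W, hxW, hW, hfW, H, hH⟩ := hI
  -- A countable fibre cannot fill `ℂ`, and closedness of `E` keeps `c` off the nearby fibres.
  obtain ⟨c, hc⟩ : ∃ c, (x₀, c) ∉ E := by
    by_contra! h
    exact not_countable_complex ((hfib x₀).1.mono fun z _ => h z)
  let U : Opens X := ⟨W ∩ {x | (x, c) ∉ E}, hW.inter
    (hcl.isOpen_compl.preimage (continuous_id.prodMk continuous_const))⟩
  let σ : ℕ → U → f ⁻¹' W := fun n x => H.symm (⟨x, x.2.1⟩, n)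
  let s : ℕ → U → ℂ := fun n x => (σ n x).1.1.2
  have hσc : ∀ n, Continuous (σ n) := fun n => H.symm.continuous.comp (by fun_prop)
  have hσf : ∀ n x, (σ n x).1.1.1 = x := by
    intro n x
    have := hH (σ n x)
    simp only [σ, Homeomorph.apply_symm_apply] at this
    exact this.symm
  have hσs : ∀ n x, (σ n x).1.1 = ((x : X), s n x) := fun n x => Prod.ext (hσf n x) rfl
  have hsE : ∀ n (x : U), ((x : X), s n x) ∈ E := fun n x => hσs n x ▸ (σ n x).1.2
  have hsn : ∀ n (x : U) (z : ℂ) (h : ((x : X), z) ∈ E), s n x = z ↔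
      (H ⟨⟨((x : X), z), h⟩, x.2.1⟩).2 = n := by
    intro n x z h
    have e1 : (H ⟨⟨((x : X), z), h⟩, x.2.1⟩).1 = ⟨x, x.2.1⟩ := Subtype.ext (hH _)
    constructor
    · rintro rfl
      have : (⟨⟨((x : X), s n x), h⟩, x.2.1⟩ : f ⁻¹' W) = σ n x :=
        Subtype.ext (Subtype.ext (hσs n x).symm)
      rw [this]
      simp only [σ, Homeomorph.apply_symm_apply]
    · intro hn
      have : σ n x = ⟨⟨((x : X), z), h⟩, x.2.1⟩ := by
        refine (H.symm_apply_eq).2 (Prod.ext e1.symm hn.symm)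
      simp only [s, this]
  refine ⟨U, c, s, ⟨hxW, hc⟩, fun n => ?_, fun x m n hmn => ?_, fun x z => ⟨fun h => ?_, ?_⟩,
    fun n x h => x.2.2 (h ▸ hsE n x), fun y₀ R => ?_⟩
  · exact continuous_snd.comp (continuous_subtype_val.comp (continuous_subtype_val.comp (hσc n)))
  · have h1 := (hsn m x _ (hsE n x)).1 hmn
    have h2 := (hsn n x _ (hsE n x)).1 rfl
    exact h1.symm.trans h2
  · exact ⟨_, (hsn _ x z h).2 rfl⟩
  · rintro ⟨n, rfl⟩
    exact hsE n x
  -- Compactness of the disc reduces this to one point `(y₀, z)`. If it lies on `E`, its sheet is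
  -- open in `E`, so a neighbourhood meets only that sheet; otherwise a neighbourhood misses the
  -- closed set `E`.
  · have key : ∃ S : Finset ℕ, ∀ᶠ y in nhds y₀, ∀ w ∈ Metric.closedBall c R, ∀ n,
        s n y = w → n ∈ S := by
      refine (isCompact_closedBall c R).induction_on
        (p := fun K => ∃ S : Finset ℕ, ∀ᶠ y in nhds y₀, ∀ w ∈ K, ∀ n, s n y = w → n ∈ S)
        ⟨∅, by simp⟩ ?_ ?_ ?_
      · rintro K L hKL ⟨S, hS⟩
        exact ⟨S, hS.mono fun y hy w hw => hy w (hKL hw)⟩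
      · classical
        rintro K L ⟨S, hS⟩ ⟨T, hT⟩
        refine ⟨S ∪ T, (hS.and hT).mono fun y hy w hw n hn => Finset.mem_union.2 ?_⟩
        exact hw.imp (fun h => hy.1 w h n hn) fun h => hy.2 w h n hn
      · intro z _
        have hι : Continuous fun q : U × ℂ => ((q.1 : X), q.2) := by fun_prop
        suffices h : ∃ S : Finset ℕ, ∀ᶠ q : U × ℂ in nhds (y₀, z), ∀ n, s n q.1 = q.2 → n ∈ S by
          obtain ⟨S, hS⟩ := h
          rw [nhds_prod_eq, Filter.eventually_prod_iff] at hS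
          obtain ⟨p, hp, q, hq, h⟩ := hS
          exact ⟨{w | q w}, mem_nhdsWithin_of_mem_nhds hq, S,
            hp.mono fun y hy w hw n hn => h hy hw n hn⟩
        by_cases hz : ((y₀ : X), z) ∈ E
        · let m := (H ⟨⟨((y₀ : X), z), hz⟩, y₀.2.1⟩).2
          have hO : IsOpen (Subtype.val '' {p : f ⁻¹' W | (H p).2 = m}) := by
            refine hfW.isOpenMap_subtype_val _ ?_
            exact (isOpen_discrete {m}).preimage (continuous_snd.comp H.continuous)
          obtain ⟨O, hO, hOE⟩ := isOpen_induced_iff.1 hO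
          have hmem : ((y₀ : X), z) ∈ O := by
            have : (⟨((y₀ : X), z), hz⟩ : E) ∈ Subtype.val ⁻¹' O := by
              rw [hOE]
              exact ⟨⟨⟨((y₀ : X), z), hz⟩, y₀.2.1⟩, rfl, rfl⟩
            exact this
          refine ⟨{m}, ?_⟩
          filter_upwards [hι.continuousAt.eventually (hO.mem_nhds hmem)] with q hq n hn
          rw [Finset.mem_singleton]
          have hqE : ((q.1 : X), q.2) ∈ E := hn ▸ hsE n q.1
          have : (⟨((q.1 : X), q.2), hqE⟩ : E) ∈ Subtype.val '' {p : f ⁻¹' W | (H p).2 = m} := by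
            rw [← hOE]
            exact hq
          obtain ⟨p, hp, hpq⟩ := this
          have e : p = ⟨⟨((q.1 : X), q.2), hqE⟩, q.1.2.1⟩ := Subtype.ext hpq
          have hp' : (H p).2 = m := hp
          rw [e] at hp'
          rw [← hp', (hsn n q.1 q.2 hqE).1 hn]
        · refine ⟨∅, ?_⟩
          filter_upwards [hι.continuousAt.eventually (hcl.isOpen_compl.mem_nhds hz)] with q hq n hn
          exact (hq (hn ▸ hsE n q.1)).elim
    obtain ⟨S, hS⟩ := key
    refine ⟨_, hS, S, fun n hn y hy => ?_⟩
    by_contra! h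
    refine hn (hy _ ?_ n rfl)
    rw [Metric.mem_closedBall, dist_eq_norm]
    exact h.le

/-- The fibres of a closed embedded covering are locally finite. -/
theorem IsClosedEmbeddedCovering.finite_fiber (hE : IsClosedEmbeddedCovering E) (x : X) (c : ℂ)
    (R : ℝ) : {z | (x, z) ∈ E ∧ ‖z - c‖ < R}.Finite := by
  obtain ⟨U, b, s, hx, -, -, hs, -, hfin⟩ := hE.exists_local_sections x
  obtain ⟨V, hV, S, hS⟩ := hfin ⟨x, hx⟩ (R + ‖c - b‖)
  refine (S.finite_toSet.image fun n => s n ⟨x, hx⟩).subset ?_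
  rintro z ⟨hz, hzR⟩
  obtain ⟨n, rfl⟩ := (hs ⟨x, hx⟩ z).1 hz
  refine ⟨n, ?_, rfl⟩
  by_contra hn
  have h1 := hS n hn _ (mem_of_mem_nhds hV)
  have h2 := norm_sub_le_norm_sub_add_norm_sub (s n ⟨x, hx⟩) c b
  linarith

/-- Weierstrass products exist locally. -/
theorem IsClosedEmbeddedCovering.exists_isLocalWeierstrassProduct
    (hE : IsClosedEmbeddedCovering E) (x : X) :
    ∃ (U : Opens X) (F : entireFamilies U), x ∈ U ∧ IsLocalWeierstrassProduct E U F := by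
  obtain ⟨U, c, s, hx, h1, h2, h3, h4, h5⟩ := hE.exists_local_sections x
  obtain ⟨F, f1, f2, f3⟩ := exists_weierstrassProduct h1 h4 h5
  exact ⟨U, ⟨F, f1, f2⟩, hx, c, s, h1, h2, h3, h4, f3⟩

/-- Weierstrass products are local realizations. -/
theorem IsLocalWeierstrassProduct.isLocalRealization (hE : IsClosedEmbeddedCovering E)
    {U : Opens X} {F : entireFamilies U} (hF : IsLocalWeierstrassProduct E U F) :
    IsLocalRealization E U F := by
  obtain ⟨c, s, -, h2, h3, h4, h5⟩ := hF
  intro x z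
  rw [h3]
  refine weierstrassProduct_simple_zeros (h2 x) (fun n => h4 n x) (fun R => ?_) (h5 x) z
  -- The definition of a Weierstrass product does not bound the number of `sₙ` in a disc; the bound
  -- comes from `E` itself, since the `sₙ` enumerate its fibre injectively.
  refine ((hE.finite_fiber x c R).preimage (h2 x).injOn).subset fun n hn => ?_
  exact ⟨(h3 x _).2 ⟨n, rfl⟩, hn⟩

end LocalSections

/-! ### The obstruction class -/

section Obstruction

variable {X : Type u} [TopologicalSpace X] {E : Set (X × ℂ)}

theorem IsRatioClass.eq {U U' : PointCover X} {F : ∀ x, entireFamilies (U.set x)}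
    {F' : ∀ x, entireFamilies (U'.set x)} (hF : ∀ x, IsLocalRealization E (U.set x) (F x))
    (hF' : ∀ x, IsLocalRealization E (U'.set x) (F' x)) {a a' : H2Z X}
    (h : IsRatioClass U F a) (h' : IsRatioClass U' F' a') : a = a' := by
  obtain ⟨γ, hγ, hc⟩ := h
  obtain ⟨γ', hγ', hc'⟩ := h'
  rw [← hγ.cechClass_eq hF hF' hγ'] at hc'
  exact hc.unique isLeftExact_exp isLocallySurjective_exp hc'

theorem exists_isRatioClass [T2Space X] [ParacompactSpace X] {U : PointCover X}
    {F : ∀ x, entireFamilies (U.set x)} (hF : ∀ x, IsLocalRealization E (U.set x) (F x)) :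
    ∃ a, IsRatioClass U F a := by
  obtain ⟨h, hh⟩ := exists_isRatioCocycle hF
  obtain ⟨a, ha⟩ := IsConnecting.exists isLeftExact_exp isLocallySurjective_exp h
  exact ⟨a, h, hh, ha⟩

/-- A cocycle of `𝒪ˣ` whose image in `H²(X; ℤ)` vanishes is a coboundary on a refinement. -/
theorem cechClass_eq_zero_of_isConnecting_zero [T2Space X] [ParacompactSpace X]
    {c : CechH (sheafOUnits X) 1} (hc : IsConnecting (twoPiI X) (expMap X) 1 c 0) : c = 0 := by
  obtain ⟨U, γ, b, α, rfl, hb, hα, hα0⟩ := hc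
  obtain ⟨V, k, β, hβ⟩ := exists_refine_mem_coboundaries hα0
  -- Subtracting `2πi β` from the logarithms `b` makes them a cocycle of `𝒪` without changing their
  -- exponentials. A primitive `e` of it exponentiates to a primitive of `γ` on `V`.
  have hcoc : refine (sheafO X) k 1 b - mapCochain (twoPiI X) V 1 β ∈ cocycles (sheafO X) V 1 := by
    change d (sheafO X) V 1 _ = 0
    rw [map_sub, d_refine, ← mapCochain_d, hβ, ← hα, mapCochain_refine, sub_self]
  obtain ⟨e, he⟩ := exists_d_eq_of_mem_cocycles_sheafO hcoc
  rw [← cechClass_refine k]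
  refine cechClass_eq_zero_of_mem ⟨mapCochain (expMap X) V 0 e, ?_⟩
  rw [← mapCochain_d, he, map_sub, mapCochain_refine, hb]
  have : mapCochain (expMap X) V 1 (mapCochain (twoPiI X) V 1 β) = 0 :=
    funext fun s => isLeftExact_exp.comp_eq_zero _ (β s)
  rw [this, sub_zero]
  rfl

/-- On the cover by copies of `X` all ratios are 1, and the zero cochains witness `IsConnecting`. -/
theorem IsRealizable.isRatioClass_zero (hE : IsRealizable E) :
    ∃ (U : PointCover X) (F : ∀ x, entireFamilies (U.set x)),
      (∀ x, IsLocalRealization E (U.set x) (F x)) ∧ IsRatioClass U F 0 := by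
  obtain ⟨F, hF, hF', rfl⟩ := hE
  let U : PointCover X := ⟨fun _ => ⊤, fun _ => trivial⟩
  let G : ∀ x, entireFamilies (U.set x) := fun _ =>
    ⟨fun p => F (p.1, p.2), hF.continuous.comp (by fun_prop), fun x => hF.entire x⟩
  refine ⟨U, G, fun _ x z => ⟨Iff.rfl, hF' x z⟩, 0, fun s => ?_, U, 0, 0, 0, ?_, ?_, ?_, ?_⟩
  · refine Eq.trans ?_ (one_mul _).symm
    rfl
  · rfl
  · exact map_zero _
  · exact (map_zero (mapCochain (twoPiI X) U 2)).trans (map_zero (d (sheafO X) U 1)).symm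
  · exact map_zero _

/-- If the class of the ratios in `H¹(X; 𝒪ˣ)` vanishes, the local realizations can be glued. -/
theorem isRealizable_of_cechClass_eq_zero (hE : IsCountableCovering E) {U : PointCover X}
    {F : ∀ x, entireFamilies (U.set x)} (hF : ∀ x, IsLocalRealization E (U.set x) (F x))
    {h : cocycles (sheafOUnits X) U 1} (hh : IsRatioCocycle U F h)
    (h0 : cechClass (sheafOUnits X) U 1 h = 0) : IsRealizable E := by
  obtain ⟨V, k, η, hη⟩ := exists_refine_mem_coboundaries h0
  let g : ∀ x, (sheafOUnits X).obj (op (V.set x)) := fun x =>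
    res (sheafOUnits X) (V.inter_const_ge x) (η fun _ => x)
  -- Since `d η` is the ratio cocycle, `g (s 1) = g (s 0) · F (s 0) / F (s 1)`, which says exactly
  -- that the products `g x · F x` agree on overlaps.
  let G : ∀ x, entireFamilies (V.set x) := fun x => unitVal (g x) * restrict (k x) (F x)
  have hne : ∀ x p, (unitVal (g x)).1 p ≠ 0 := fun x =>
    (isUnit_iff_ne_zero _).1 (Units.isUnit _)
  have hG : ∀ x, IsLocalRealization E (V.set x) (G x) := by
    intro x y z
    have e : (G x).1 (y, z) = (unitVal (g x)).1 (y, z) * (F x).1 (Set.inclusion (k x) y, z) := rfl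
    have hz : (G x).1 (y, z) = 0 ↔ (F x).1 (Set.inclusion (k x) y, z) = 0 := by
      rw [e, mul_eq_zero, or_iff_right (hne x _)]
    have hFx := hF x (Set.inclusion (k x) y) z
    refine ⟨hz.trans hFx.1, fun h1 => ?_⟩
    have h2 := hz.1 h1
    have d1 := ((unitVal (g x)).2.2 y z).hasDerivAt
    have d2 := ((F x).2.2 (Set.inclusion (k x) y) z).hasDerivAt
    have d3 : HasDerivAt (fun w => (G x).1 (y, w))
        (deriv (fun w => (unitVal (g x)).1 (y, w)) z * (F x).1 (Set.inclusion (k x) y, z) +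
          (unitVal (g x)).1 (y, z) * deriv (fun w => (F x).1 (Set.inclusion (k x) y, w)) z) z :=
      d1.mul d2
    rw [h2, mul_zero, zero_add] at d3
    rw [d3.deriv]
    exact mul_ne_zero (hne x _) (hFx.2 h2)
  have hglue : ∀ s : Fin 2 → X,
      restrict (V.inter_le s 0) (G (s 0)) = restrict (V.inter_le s 1) (G (s 1)) := by
    intro s
    have e1 := congrArg (restrict (PointCover.inter_mono k s)) (isRatioCocycle_iff.1 hh s)
    have e2 : res (sheafOUnits X) (V.inter_le s 1) (g (s 1)) =
        res (sheafOUnits X) (V.inter_le s 0) (g (s 0)) +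
        res (sheafOUnits X) (PointCover.inter_mono k s) (h.1 s) := by
      have := congrFun hη s
      rw [d_zero_apply] at this
      simp only [g, res_res]
      exact (sub_eq_iff_eq_add'.1 this)
    have e3 : restrict (V.inter_le s 1) (unitVal (g (s 1))) =
        restrict (V.inter_le s 0) (unitVal (g (s 0))) *
          restrict (PointCover.inter_mono k s) (unitVal (h.1 s)) := congrArg unitVal e2
    rw [map_mul] at e1
    simp only [G, map_mul]
    rw [e3, mul_assoc]
    exact congrArg _ e1
  have hval : ∀ x y (p : X) (z : ℂ) (hx : p ∈ V.set x) (hy : p ∈ V.set y),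
      (G x).1 (⟨p, hx⟩, z) = (G y).1 (⟨p, hy⟩, z) := by
    intro x y p z hx hy
    have hp : p ∈ V.inter ![x, y] :=
      PointCover.mem_inter.2 fun i => by fin_cases i <;> assumption
    exact congrFun (congrArg Subtype.val (hglue ![x, y])) (⟨p, hp⟩, z)
  -- `Φ` changes index with the base point; `hΦ` replaces the varying index by a fixed one near a
  -- given point, where continuity is then clear.
  let Φ : X × ℂ → ℂ := fun p => (G p.1).1 (⟨p.1, V.mem p.1⟩, p.2)
  have hΦ : ∀ x p, p.1 ∈ V.set x → Φ p = extendZero (G x) p := fun x p hp =>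
    (hval _ _ _ _ _ hp).trans (extendZero_of_mem (G x) hp).symm
  have hzero : zeroLocus Φ = E := by
    ext ⟨x, z⟩
    exact (hG x ⟨x, V.mem x⟩ z).1
  refine ⟨Φ, ⟨continuous_iff_continuousAt.2 fun p => ?_, fun x => ?_, hzero ▸ hE⟩, ?_, hzero⟩
  · have hopen : {q : X × ℂ | q.1 ∈ V.set p.1} ∈ nhds p :=
      ((V.set p.1).2.preimage continuous_fst).mem_nhds (V.mem p.1)
    refine ((continuousOn_extendZero (G p.1)).continuousAt hopen).congr ?_
    filter_upwards [hopen] with q hq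
    exact (hΦ _ _ hq).symm
  · exact (G x).2.2 ⟨x, V.mem x⟩
  · intro x z h
    exact (hG x ⟨x, V.mem x⟩ z).2 h

theorem IsClosedEmbeddedCovering.exists_isObstructionClass [T2Space X] [ParacompactSpace X]
    (hE : IsClosedEmbeddedCovering E) : ∃ a, IsObstructionClass E a := by
  choose U F hU hF using hE.exists_isLocalWeierstrassProduct
  obtain ⟨a, ha⟩ := exists_isRatioClass (U := ⟨U, hU⟩) (F := F)
    fun x => (hF x).isLocalRealization hE
  exact ⟨a, ⟨U, hU⟩, F, hF, ha⟩

/-- Every choice of local realizations computes the obstruction class. -/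
theorem IsClosedEmbeddedCovering.isRatioClass_iff [T2Space X] [ParacompactSpace X]
    (hE : IsClosedEmbeddedCovering E) {U : PointCover X} {F : ∀ x, entireFamilies (U.set x)}
    (hF : ∀ x, IsLocalRealization E (U.set x) (F x)) (a : H2Z X) :
    IsRatioClass U F a ↔ a = c1 E := by
  obtain ⟨V, G, hG, hc⟩ : IsObstructionClass E (c1 E) :=
    Classical.epsilon_spec hE.exists_isObstructionClass
  have hG' := fun x => (hG x).isLocalRealization hE
  refine ⟨fun h => h.eq hF hG' hc, ?_⟩
  rintro rfl
  -- These realizations have some class, and uniqueness identifies it with `c1 E`.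
  obtain ⟨b, hb⟩ := exists_isRatioClass hF
  rwa [← hb.eq hF hG' hc]

end Obstruction

end WeierstrassCovering

end

open WeierstrassCovering in
/-- The first two conjuncts say that the class `c₁(E)` exists and does not depend on the choice of
the cover and of the local realizations. -/
theorem mainTheorem5 {X : Type*} [TopologicalSpace X] [T2Space X] [ParacompactSpace X]
    (hX : LocallyContractibleSpace X) (E : Set (X × ℂ)) (hE : IsClosedEmbeddedCovering E) :
    (∀ a : H2Z X, IsObstructionClass E a ↔ a = c1 E) ∧
    (∀ (U : PointCover X) (F : ∀ x, entireFamilies (U.set x)),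
      (∀ x, IsLocalRealization E (U.set x) (F x)) →
        ∀ a : H2Z X, IsRatioClass U F a ↔ a = c1 E) ∧
    (IsRealizable E ↔ c1 E = 0) ∧
    (Subsingleton (H2Z X) → IsRealizable E) := by
  have hc : IsObstructionClass E (c1 E) := Classical.epsilon_spec hE.exists_isObstructionClass
  have hreal : IsRealizable E ↔ c1 E = 0 := by
    constructor
    · intro h
      obtain ⟨U, F, hF, h0⟩ := h.isRatioClass_zero
      exact ((hE.isRatioClass_iff hF 0).1 h0).symm
    · intro h
      obtain ⟨U, F, hF, γ, hγ, hconn⟩ := hc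
      rw [h] at hconn
      exact isRealizable_of_cechClass_eq_zero hE.2 (fun x => (hF x).isLocalRealization hE) hγ
        (cechClass_eq_zero_of_isConnecting_zero hconn)
  refine ⟨fun a => ⟨?_, ?_⟩, fun U F hF a => hE.isRatioClass_iff hF a, hreal, fun h => ?_⟩
  · rintro ⟨U, F, hF, ha⟩
    exact (hE.isRatioClass_iff (fun x => (hF x).isLocalRealization hE) a).1 ha
  · rintro rfl
    exact hc
  · exact hreal.2 (Subsingleton.elim _ _)
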